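/- **Notation.** Let $r\ge 1$ and $1\le d\le r$. An *augmented knot sequence* with $l$ interior knots is a sequence of reals $$t_{-r+1}\le\cdots\le t_0=0<t_1<\cdots<t_l<1=t_{l+1}\le\cdots\le t_{l+r}.$$ Its outer knots are *controlled* if $t_i-t_{i-1}\le t_1-t_0$ for $-r+1<i\le 0$ and $t_{i+1}-t_i\le t_{l+1}-t_l$ for $l+1\le i<l+r$. The *basic knots* $t_1'\le t_2'\le\cdots$ are the knots $t_i$ in increasing order, with each of $t_1,\dots,t_l$ repeated $d$ times. Put $k=r+ld$. The *Schoenberg space* $S_r(T,d)$ consists of the functions on $[0,1]$ that are a polynomial of degree at most $r-1$ on each interval $(t_i,t_{i+1})$, $0\le i\le l$, and are $r-1-d$ times continuously differentiable in a neighbourhood of each $t_i$, $1\le i\le l$ (no restriction if $d=r$). Let $N_1,\dots,N_k$ be the normalized B-splines of order $r$ for the basic knots (given by the Cox–de Boor recursion; $N_j$ vanishes outside $[t_j',t_{j+r}']$). A *quasi-interpolant with constant $C$* is an operator $f\mapsto\sum_{j=1}^k c_j(f)N_j$, with $c_j(f)=\int_0^1 f(x)c_j(x)\,dx$ for measurable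 $c_j\in L_\infty[0,1]$, that is a projection of $L_1[0,1]$ onto $S_r(T,d)$ (it maps into $S_r(T,d)$ and fixes each $f\in S_r(T,d)$ almost everywhere) and satisfies, for all $j$, all $1\le p\le\infty$ and all $f\in L_p[0,1]$, $$|c_j(f)|\le C\,(t_{j+r}'-t_j')^{-1/p}\,\|f1_{[t_j',t_{j+r}']}\|_{L_p[0,1]}.$$ Its symmetrized kernel is $\tfrac12\bigl(K(x_1,x_2)+K(x_2,x_1)\bigr)$ with $K(x_1,x_2)=\sum_{j=1}^kN_j(x_1)c_j(x_2)$. **Proposition.** Let $r\ge1$. (i) There is a constant $C_r$, depending on $r$ only, such that for every $1\le d\le r$, every $l\ge 0$ and every augmented knot sequence with $l$ interior knots and controlled outer knots there is a quasi-interpolant with constant $C_r$. (ii) Let $1\le d\le r$. For each $l\ge1$ let $(t_i^l)_i$ be an augmented knot sequence with $l$ interior knots such that $a/l\le t^l_{i+1}-t^l_i\le b/l$ for all $0\le i\le l$, with constants $0<a\le b$ not depending on $l$, and for each $l\ge 1$ take a quasi-interpolant with a constant $C$ not depending on $l$. Let $l_n\ge1$ be integers with $l_n/n\to\infty$ and $l_n/n^2\to0$,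 and let $K_n$ be the symmetrized kernel for $l=l_n$. Let $(X,Y)$ be a random vector in $\mathbb R^2$ such that the law $G$ of $X$ is concentrated on $[0,1]$ with a Lebesgue density on $[0,1]$ that is bounded and bounded away from zero, let $q>2$, $E|Y|^q<\infty$, and let $\mu_2(x)=E(Y^2\mid X=x)$ and $\mu_q(x)=E(|Y|^q\mid X=x)$ be $G$-almost everywhere bounded and bounded away from zero. Then the kernels $K_n$ are symmetric, measurable and square-integrable for $G\times G$, and with $$k_n=\iint K_n^2\,(\mu_2\times\mu_2)\,d(G\times G),\qquad K_nf(x)=\int f(v)K_n(x,v)\,dG(v),$$ where $(\mu\times\mu)(x,y)=\mu(x)\mu(y)$, the operator norms on $L_2(G)$ satisfy $\sup_n\|K_n\|<\infty$, one has $k_n/n\to\infty$, and there exist finite partitions $[0,1]=\bigcup_m\mathcal X_{n,m}$ into measurable sets such that, as $n\to\infty$, $$\frac1{k_n}\sum_m\int_{\mathcal X_{n,m}}\!\int_{\mathcal X_{n,m}}K_n^2\,(\mu_2\times\mu_2)\,d(G\times G)\to1,$$ $$\frac1{k_n}\max_m\int_{\mathcal X_{n,m}}\!\int_{\mathcal X_{n,m}}K_n^2\,(\mu_2\times\mu_2)\,d(G\times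 G)\to0,$$ $$\max_mG(\mathcal X_{n,m})\to0,\qquad \liminf_{n\to\infty}\,n\min_mG(\mathcal X_{n,m})>0,$$ $$\frac1{k_n^{q/2}}\max_m\Bigl(\frac{G(\mathcal X_{n,m})}n\Bigr)^{q/2-1}\sum_m\int_{\mathcal X_{n,m}}\!\int_{\mathcal X_{n,m}}|K_n|^q\,(\mu_q\times\mu_q)\,d(G\times G)\to0.$$ -/

import Mathlib

open MeasureTheory ProbabilityTheory Filter Set
open scoped ENNReal Topology

noncomputable section

/-! ### Knots, B-splines and Schoenberg spaces -/

/-- Lebesgue measure on `[0,1]`. -/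
def leb01 : Measure ℝ := volume.restrict (Icc 0 1)

/-- Augmented knot sequence
`t_{-r+1} ≤ ⋯ ≤ t_0 = 0 < t_1 < ⋯ < t_l < 1 = t_{l+1} ≤ ⋯ ≤ t_{l+r}`;
only the values `t i` with `-r+1 ≤ i ≤ l+r` are relevant. -/
structure IsAugmentedKnots (r l : ℕ) (t : ℤ → ℝ) : Prop where
  zero : t 0 = 0
  one : t (l + 1) = 1
  inner : ∀ i : ℤ, 0 ≤ i → i ≤ l → t i < t (i + 1)
  left : ∀ i : ℤ, -(r : ℤ) + 1 ≤ i → i < 0 → t i ≤ t (i + 1)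
  right : ∀ i : ℤ, (l : ℤ) + 1 ≤ i → i < l + r → t i ≤ t (i + 1)

/-- The knot intervals outside `(0,1)` are not longer than the adjacent extreme knot interval
inside `(0,1)`. -/
structure OuterKnotsControlled (r l : ℕ) (t : ℤ → ℝ) : Prop where
  left : ∀ i : ℤ, -(r : ℤ) + 1 < i → i ≤ 0 → t i - t (i - 1) ≤ t 1 - t 0
  right : ∀ i : ℤ, (l : ℤ) + 1 ≤ i → i < l + r → t (i + 1) - t i ≤ t (l + 1) - t l

/-- The basic knots: the augmented knot sequence with each interior knot `t_1, …, t_l`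
repeated `d` times, enumerated in increasing order as `t'_0, …, t'_{2r+ld-1}`. -/
def basicKnots (r d l : ℕ) (t : ℤ → ℝ) (m : ℕ) : ℝ :=
  if m < r then t ((m : ℤ) - r + 1)
  else if m < r + l * d then t (1 + ((m - r) / d : ℕ))
  else t ((l : ℤ) + 1 + (m - (r + l * d) : ℕ))

/-- The normalized B-spline of order `r` for the knots `s j ≤ ⋯ ≤ s (j+r)`, by the Cox-de Boor
recursion (a quotient with denominator zero is zero, which is the usual convention). -/
def bspline (s : ℕ → ℝ) : ℕ → ℕ → ℝ → ℝ
  | 0, _, _ => 0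
  | 1, j, x => (Ico (s j) (s (j + 1))).indicator 1 x
  | r + 2, j, x =>
      (x - s j) / (s (j + r + 1) - s j) * bspline s (r + 1) j x
      + (s (j + r + 2) - x) / (s (j + r + 2) - s (j + 1)) * bspline s (r + 1) (j + 1) x

/-- The basis function `N_j`, `0 ≤ j < r + l d`. -/
def splineBasis (r d l : ℕ) (t : ℤ → ℝ) (j : ℕ) : ℝ → ℝ :=
  bspline (basicKnots r d l t) r j

/-- The Schoenberg space of order `r` with all defects equal to `d`: piecewise polynomials of
degree at most `r - 1` that are `r - 1 - d` times continuously differentiable in a neighbourhood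
of each interior knot (no restriction if `d = r`). Only the values on `[0,1]` matter. -/
def schoenbergSpace (r d l : ℕ) (t : ℤ → ℝ) : Set (ℝ → ℝ) :=
  {f | (∀ i : ℤ, 0 ≤ i → i ≤ l → ∃ p : Polynomial ℝ, p.degree < r ∧
          ∀ x ∈ Ioo (t i) (t (i + 1)), f x = p.eval x) ∧
       (d < r → ∀ i : ℤ, 1 ≤ i → i ≤ l → ContDiffAt ℝ ((r - 1 - d : ℕ) : WithTop ℕ∞) f (t i))}

/-! ### Quasi-interpolants and their kernels -/

/-- The functional `f ↦ ∫₀¹ f φ` with representing function `φ`. -/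
def coeffFunctional (φ f : ℝ → ℝ) : ℝ := ∫ x, f x * φ x ∂leb01

/-- The operator `f ↦ ∑ⱼ cⱼ(f) Nⱼ`. -/
def splineOp (r d l : ℕ) (t : ℤ → ℝ) (c : ℕ → ℝ → ℝ) (f : ℝ → ℝ) : ℝ → ℝ := fun x =>
  ∑ j ∈ Finset.range (r + l * d), coeffFunctional (c j) f * splineBasis r d l t j x

/-- The functions `c_j`, `j < r + l d`, represent a quasi-interpolant operator with constant `C`:
`f ↦ ∑ⱼ cⱼ(f) Nⱼ` is a projection of `L₁[0,1]` onto the Schoenberg space, and for every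
`p ∈ [1,∞]` one has
`|c_j(f)| ≤ C (t'_{j+r} - t'_j)^{-1/p} ‖f 1_{[t'_j, t'_{j+r}]}‖_p`. -/
structure IsQuasiInterpolant (r d l : ℕ) (t : ℤ → ℝ) (C : ℝ) (c : ℕ → ℝ → ℝ) : Prop where
  measurable : ∀ j < r + l * d, Measurable (c j)
  memLp_top : ∀ j < r + l * d, MemLp (c j) ∞ leb01
  range_mem : ∀ f, Integrable f leb01 → splineOp r d l t c f ∈ schoenbergSpace r d l t
  proj : ∀ f ∈ schoenbergSpace r d l t, splineOp r d l t c f =ᵐ[leb01] f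
  bound : ∀ j < r + l * d, ∀ p : ℝ≥0∞, 1 ≤ p → ∀ f, MemLp f p leb01 →
    |coeffFunctional (c j) f| ≤
      C * (basicKnots r d l t (j + r) - basicKnots r d l t j) ^ (-(p⁻¹).toReal) *
        (eLpNorm ((Icc (basicKnots r d l t j) (basicKnots r d l t (j + r))).indicator f)
          p leb01).toReal

/-- The kernel `(x₁, x₂) ↦ ∑ⱼ Nⱼ(x₁) cⱼ(x₂)`. -/
def splineKernel (r d l : ℕ) (t : ℤ → ℝ) (c : ℕ → ℝ → ℝ) (x₁ x₂ : ℝ) : ℝ :=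
  ∑ j ∈ Finset.range (r + l * d), splineBasis r d l t j x₁ * c j x₂

/-- Symmetrization of a kernel. -/
def symmetrize (K : ℝ → ℝ → ℝ) (x₁ x₂ : ℝ) : ℝ := (K x₁ x₂ + K x₂ x₁) / 2

/-! ### Distributional assumptions -/

/-- `G` is a measure on `[0,1]` with a Lebesgue density bounded and bounded away from zero. -/
def HasDensityBoundedAway (G : Measure ℝ) : Prop :=
  ∃ g : ℝ → ℝ, Measurable g ∧ (∃ a b : ℝ, 0 < a ∧ ∀ x ∈ Icc (0 : ℝ) 1, a ≤ g x ∧ g x ≤ b) ∧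
    G = leb01.withDensity (fun x => ENNReal.ofReal (g x))

/-- `m` is a version of `x ↦ E(|Y|^q | X = x)`. -/
structure IsCondAbsMoment {Ω : Type*} [MeasurableSpace Ω] (P : Measure Ω) (X Y : Ω → ℝ)
    (q : ℝ) (m : ℝ → ℝ) : Prop where
  measurable : Measurable m
  integrable : Integrable (fun ω => |Y ω| ^ q) P
  eq_condExp : (fun ω => m (X ω)) =ᵐ[P]
    P[fun ω => |Y ω| ^ q | MeasurableSpace.comap X inferInstance]

/-- `m` is bounded and bounded away from zero, up to a `G`-null set. -/
def BoundedAndAway (G : Measure ℝ) (m : ℝ → ℝ) : Prop :=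
  ∃ a b : ℝ, 0 < a ∧ ∀ᵐ x ∂G, a ≤ m x ∧ m x ≤ b

/-! ### The conditions on a sequence of kernels -/

/-- The kernel operator `f ↦ ∫ f(v) K(·,v) dG(v)`. -/
def kernelOp (G : Measure ℝ) (K : ℝ → ℝ → ℝ) (f : ℝ → ℝ) (x : ℝ) : ℝ :=
  ∫ v, f v * K x v ∂G

/-- The norm of the kernel operator on `L₂(G)`. -/
def kernelOpNorm (G : Measure ℝ) (K : ℝ → ℝ → ℝ) : ℝ≥0∞ :=
  ⨆ (f : ℝ → ℝ) (_ : MemLp f 2 G) (_ : eLpNorm f 2 G = 1), eLpNorm (kernelOp G K f) 2 G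

/-- `∫_A ∫_A |K|^p (m × m) d(G × G)`. -/
def blockMoment (G : Measure ℝ) (p : ℝ) (m : ℝ → ℝ) (K : ℝ → ℝ → ℝ) (A : Set ℝ) : ℝ≥0∞ :=
  ∫⁻ z in A ×ˢ A, ENNReal.ofReal (|K z.1 z.2| ^ p * (m z.1 * m z.2)) ∂(G.prod G)

/-- The weighted square norm `∫∫ K² (μ₂ × μ₂) d(G × G)`. -/
def kernelSize (G : Measure ℝ) (μ₂ : ℝ → ℝ) (K : ℝ → ℝ → ℝ) : ℝ≥0∞ :=
  blockMoment G 2 μ₂ K univ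

/-- A finite partition of `[0,1]` in measurable sets. -/
structure IsMeasurablePartition {M : ℕ} (A : Fin M → Set ℝ) : Prop where
  measurableSet : ∀ m, MeasurableSet (A m)
  disjoint : Pairwise (Function.onFun Disjoint A)
  iUnion_eq : ⋃ m, A m = Icc (0 : ℝ) 1

/-- The conditions on a sequence of partitions, for the kernels `K n` and the exponent `q`. -/
structure PartitionConditions (G : Measure ℝ) (μ₂ μq : ℝ → ℝ) (q : ℝ) (K : ℕ → ℝ → ℝ → ℝ)
    (M : ℕ → ℕ) (A : ∀ n, Fin (M n) → Set ℝ) : Prop where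
  partition : ∀ n, IsMeasurablePartition (A n)
  diagonal : Tendsto (fun n => (∑ m, blockMoment G 2 μ₂ (K n) (A n m)) / kernelSize G μ₂ (K n))
    atTop (𝓝 1)
  block_small : Tendsto
    (fun n => (⨆ m, blockMoment G 2 μ₂ (K n) (A n m)) / kernelSize G μ₂ (K n)) atTop (𝓝 0)
  prob_small : Tendsto (fun n => ⨆ m, G (A n m)) atTop (𝓝 0)
  prob_large : 0 < liminf (fun n : ℕ => (n : ℝ≥0∞) * ⨅ m, G (A n m)) atTop
  lyapunov : Tendsto
    (fun n : ℕ => (⨆ m, (G (A n m) / (n : ℝ≥0∞)) ^ (q / 2 - 1)) *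
      (∑ m, blockMoment G q μq (K n) (A n m)) / kernelSize G μ₂ (K n) ^ (q / 2))
    atTop (𝓝 0)

/-- All the conditions on the kernels: they are symmetric, measurable and square integrable, the
operator norms are uniformly bounded, `k_n / n → ∞` for the weighted square norms `k_n`, and there
are partitions with the required properties. -/
structure KernelConditions (G : Measure ℝ) (μ₂ μq : ℝ → ℝ) (q : ℝ) (K : ℕ → ℝ → ℝ → ℝ) :
    Prop where
  symm : ∀ n x y, K n x y = K n y x
  measurable : ∀ n, Measurable (Function.uncurry (K n))
  sq_integrable : ∀ n, ∫⁻ z, ENNReal.ofReal (K n z.1 z.2 ^ 2) ∂(G.prod G) < ∞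
  bounded_norms : ⨆ n, kernelOpNorm G (K n) < ∞
  size_large : Tendsto (fun n : ℕ => kernelSize G μ₂ (K n) / (n : ℝ≥0∞)) atTop (𝓝 ∞)
  exists_partition : ∃ (M : ℕ → ℕ) (A : ∀ n, Fin (M n) → Set ℝ),
    PartitionConditions G μ₂ μq q K M A

end

/-! Write r = n + 1.

Part (i). On a knot interval each B-spline is a polynomial, and `marsden` expands (X - x)^n in the
B-splines with coefficients ψ_j = ∏ (X - s_{j+i}). Pairing this identity with a polynomial p by the
bilinear form ∑ (-1)^m p^{(m)} ψ^{(n-m)}, which is independent of the point of evaluation, gives the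
de Boor–Fix functionals: they return the B-spline coefficients of p. Two adjacent pieces of a spline
differ by a multiple of (X - τ)^{r-d}, while ψ_j contains (X - τ)^d if the support of N_j covers
both intervals; the form then vanishes at τ, so the coefficient can be computed from any interval in
the support (`KnotLayout.dualFunctional_congr`). Conversely, a dimension count shows that the
B-splines satisfy the smoothness conditions (`X_sub_C_pow_dvd_bsplinePoly_sub`). Choosing the
longest interior interval in the support, whose length is comparable to that of the support when the
outer knots are controlled, the functional is integration against a function of size O(1/length)
(`exists_dual_density`). Hölder's inequality gives all the L_p bounds.

Part (ii). The bound for p = 1 forces |c_j| ≤ C/length on the support and c_j = 0 off it. Hence the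
kernel is O(l) and vanishes at distance O(1/l) from the diagonal (`KnotLayout.exists_kernel_band`);
Schur's test bounds the operator norms. The c_j are biorthogonal to the N_j, so ∫∫ K(x,y)K(y,x) is
the trace r + ld of the projection; it bounds the square norm of the symmetrized kernel from below
(`KnotLayout.le_lintegral_symmetrize_sq`). So k_n has exact order l_n. For a partition in n + 1
equal cells the off-diagonal blocks carry mass O(n) = o(l_n), and the last condition reduces to
(l_n/n²)^{q/2-1} → 0 (`kernelConditions_of_band`). -/

/-! ### B-splines as piecewise polynomials -/

open Polynomial in
/-- The polynomial that agrees with the B-spline on the knot interval `[s μ, s (μ + 1))`. -/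
noncomputable def bsplinePoly (s : ℕ → ℝ) (μ : ℕ) : ℕ → ℕ → ℝ[X]
  | 0, _ => 0
  | 1, j => if j = μ then 1 else 0
  | r + 2, j =>
      C (s (j + r + 1) - s j)⁻¹ * (X - C (s j)) * bsplinePoly s μ (r + 1) j
      + C (s (j + r + 2) - s (j + 1))⁻¹ * (C (s (j + r + 2)) - X) *
        bsplinePoly s μ (r + 1) (j + 1)

theorem mem_Ico_knots_iff {s : ℕ → ℝ} (hs : Monotone s) {μ j : ℕ} {x : ℝ}
    (hx : x ∈ Ico (s μ) (s (μ + 1))) : x ∈ Ico (s j) (s (j + 1)) ↔ j = μ := by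
  constructor
  · intro hj
    rcases lt_trichotomy j μ with h | h | h
    · have := hs (show j + 1 ≤ μ from h)
      linarith [hj.2, hx.1]
    · exact h
    · have := hs (show μ + 1 ≤ j from h)
      linarith [hj.1, hx.2]
  · rintro rfl
    exact hx

theorem bspline_eq_eval {s : ℕ → ℝ} (hs : Monotone s) {μ : ℕ} {x : ℝ}
    (hx : x ∈ Ico (s μ) (s (μ + 1))) (r j : ℕ) :
    bspline s r j x = (bsplinePoly s μ r j).eval x := by
  fun_induction bsplinePoly s μ r j with
  | case1 => simp [bspline]
  | case2 => simp [bspline, Set.indicator, hx.1, hx.2]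
  | case3 j h =>
    have : x ∉ Ico (s j) (s (j + 1)) := fun h' => h ((mem_Ico_knots_iff hs hx).1 h')
    simp [bspline, this]
  | case4 r j ih1 ih2 =>
    simp [bspline, ih1, ih2]
    ring

/-- Used to exchange the basic knots, which are meaningful up to a last index only, for a sequence
that is monotone on all of `ℕ`. -/
theorem bspline_congr {s s' : ℕ → ℝ} (r j : ℕ) (h : ∀ m, j ≤ m → m ≤ j + r → s m = s' m) :
    bspline s r j = bspline s' r j := by
  funext x
  fun_induction bspline s r j x with
  | case1 => simp [bspline]
  | case2 j x =>
    simp [bspline, h j (by omega) (by omega), h (j + 1) (by omega) (by omega)]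
  | case3 r j x ih1 ih2 =>
    simp only [bspline]
    rw [ih1 fun m h1 h2 => h m h1 (by omega), ih2 fun m h1 h2 => h m (by omega) (by omega),
      h j (by omega) (by omega), h (j + 1) (by omega) (by omega),
      h (j + r + 1) (by omega) (by omega), h (j + r + 2) (by omega) (by omega)]

theorem measurable_bspline (s : ℕ → ℝ) (r j : ℕ) : Measurable (bspline s r j) := by
  induction r using Nat.twoStepInduction generalizing j with
  | zero => exact measurable_const
  | one => exact measurable_one.indicator measurableSet_Ico
  | more r _ ih =>
    have h1 := ih j
    have h2 := ih (j + 1)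
    change Measurable fun x => (x - s j) / (s (j + r + 1) - s j) * bspline s (r + 1) j x
      + (s (j + r + 2) - x) / (s (j + r + 2) - s (j + 1)) * bspline s (r + 1) (j + 1) x
    fun_prop

theorem bsplinePoly_eq_zero (s : ℕ → ℝ) (μ r j : ℕ) (h : μ < j ∨ j + r ≤ μ) :
    bsplinePoly s μ r j = 0 := by
  fun_induction bsplinePoly s μ r j with
  | case1 => rfl
  | case2 => omega
  | case3 => rfl
  | case4 r j ih1 ih2 => rw [ih1 (by omega), ih2 (by omega)]; simp

theorem bsplinePoly_degree_lt (s : ℕ → ℝ) (μ r j : ℕ) :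
    (bsplinePoly s μ r j).degree < r := by
  fun_induction bsplinePoly s μ r j with
  | case1 => simp
  | case2 => simp
  | case3 => simp
  | case4 r j ih1 ih2 =>
    -- Both linear factors of the recursion have the form b + cX with c = ±1, so one estimate serves
    -- both.
    have key : ∀ (a b c : ℝ) (p : Polynomial ℝ), p.degree < ((r + 1 : ℕ) : WithBot ℕ) →
        (Polynomial.C a * (Polynomial.C b + Polynomial.C c * Polynomial.X) * p).degree <
          ((r + 2 : ℕ) : WithBot ℕ) := by
      intro a b c p hp
      rw [← Polynomial.mem_degreeLT] at hp ⊢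
      have e : Polynomial.C a * (Polynomial.C b + Polynomial.C c * Polynomial.X) * p
          = (a * b) • p + (a * c) • (p * Polynomial.X) := by
        simp only [Polynomial.smul_eq_C_mul, map_mul]; ring
      rw [e]
      refine Submodule.add_mem _ (Submodule.smul_mem _ _ ?_) (Submodule.smul_mem _ _ ?_)
      · exact Polynomial.degreeLT_mono (by omega) hp
      · rw [Polynomial.mem_degreeLT] at hp ⊢
        rcases eq_or_ne p 0 with rfl | h0
        · rw [zero_mul, Polynomial.degree_zero]; exact WithBot.bot_lt_coe _
        · rw [Polynomial.degree_mul, Polynomial.degree_X]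
          rw [Polynomial.degree_eq_natDegree h0] at hp ⊢
          norm_cast at hp ⊢
          omega
    refine (Polynomial.degree_add_le _ _).trans_lt (max_lt ?_ ?_)
    · have := key (s (j + r + 1) - s j)⁻¹ (-s j) 1 _ ih1
      rwa [Polynomial.C_neg, Polynomial.C_1, one_mul, neg_add_eq_sub] at this
    · have := key (s (j + r + 2) - s (j + 1))⁻¹ (s (j + r + 2)) (-1) _ ih2
      rwa [Polynomial.C_neg, Polynomial.C_1, neg_one_mul, ← sub_eq_add_neg] at this

theorem bspline_nonneg {s : ℕ → ℝ} (hs : Monotone s) {μ : ℕ} {x : ℝ}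
    (hx : x ∈ Ico (s μ) (s (μ + 1))) (r j : ℕ) : 0 ≤ bspline s r j x := by
  fun_induction bspline s r j x with
  | case1 => simp
  | case2 => exact Set.indicator_nonneg (fun _ _ => zero_le_one) _
  | case3 r j x ih1 ih2 =>
    -- The linear factors can be negative outside the support, but there the lower order B-spline
    -- vanishes.
    have hz : ∀ j, μ < j ∨ j + (r + 1) ≤ μ → bspline s (r + 1) j x = 0 := fun j h => by
      rw [bspline_eq_eval hs hx, bsplinePoly_eq_zero _ _ _ _ h, Polynomial.eval_zero]
    refine add_nonneg ?_ ?_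
    · by_cases h : μ < j ∨ j + (r + 1) ≤ μ
      · rw [hz j h, mul_zero]
      · refine mul_nonneg (div_nonneg ?_ ?_) (ih1 hx)
        · linarith [hx.1, hs (show j ≤ μ by omega)]
        · linarith [hs (show j ≤ j + r + 1 by omega)]
    · by_cases h : μ < j + 1 ∨ j + 1 + (r + 1) ≤ μ
      · rw [hz _ h, mul_zero]
      · refine mul_nonneg (div_nonneg ?_ ?_) (ih2 hx)
        · linarith [hx.2, hs (show μ + 1 ≤ j + r + 2 by omega)]
        · linarith [hs (show j + 1 ≤ j + r + 2 by omega)]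

/-! ### Marsden's identity and the de Boor–Fix functionals -/

open Polynomial in
/-- The product `∏_{i=1}^n (X - s_{j+i})`. -/
noncomputable def dualPoly (s : ℕ → ℝ) (n j : ℕ) : ℝ[X] :=
  ∏ i ∈ Finset.range n, (X - C (s (j + 1 + i)))

open Polynomial in
-- Marsden's identity, by induction on the order. The recursion distributes each B-spline of lower
-- order over two neighbours; its two contributions recombine because X - x is the interpolation in
-- x between the factors X - s_j and X - s_{j+n+1}. The condition n ≤ μ guarantees that none of the
-- B-splines that live on the interval has a negative index.
theorem marsden {s : ℕ → ℝ} (hs : Monotone s) {μ : ℕ} (hμ : s μ < s (μ + 1)) (x : ℝ)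
    {M : ℕ} (hM : μ < M) (n : ℕ) (hn : n ≤ μ) :
    ∑ j ∈ Finset.range M, C ((bsplinePoly s μ (n + 1) j).eval x) * dualPoly s n j =
      (X - C x) ^ n := by
  induction n with
  | zero =>
    simp only [bsplinePoly, dualPoly]
    rw [Finset.sum_eq_single μ]
    · simp
    · intro b _ hb; simp [hb]
    · simp [hM]
  | succ n ih =>
    rw [pow_succ, ← ih (by omega), Finset.sum_mul]
    set B : ℕ → ℝ := fun j => (bsplinePoly s μ (n + 1) j).eval x with hB
    have hB0 : ∀ j, μ < j ∨ j + (n + 1) ≤ μ → B j = 0 := fun j h => by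
      simp only [hB]; rw [bsplinePoly_eq_zero _ _ _ _ h, eval_zero]
    -- `F (j + 1)` is the second term of the recursion for index `j`, so that a shift of the index
    -- collects the terms with the same `B j`.
    set F : ℕ → ℝ[X] := fun j =>
      C (((s (j + n + 1) - x) / (s (j + n + 1) - s j)) * B j) * ((X - C (s j)) * dualPoly s n j)
      with hF
    have h1 : ∀ j, C ((bsplinePoly s μ (n + 1 + 1) j).eval x) * dualPoly s (n + 1) j =
        C ((x - s j) / (s (j + n + 1) - s j) * B j) *
          (dualPoly s n j * (X - C (s (j + n + 1)))) + F (j + 1) := by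
      intro j
      have e1 : dualPoly s (n + 1) j = dualPoly s n j * (X - C (s (j + n + 1))) := by
        simp only [dualPoly]
        rw [Finset.prod_range_succ]
        congr 4
        omega
      have e2 : dualPoly s (n + 1) j = (X - C (s (j + 1))) * dualPoly s n (j + 1) := by
        simp only [dualPoly]
        rw [Finset.prod_range_succ', mul_comm]
        congr 1
        refine Finset.prod_congr rfl fun i _ => ?_
        congr 3
        omega
      simp only [hF]
      rw [← e1, ← e2, ← add_mul, ← C_add]
      congr 2
      simp only [bsplinePoly, hB]
      have e3 : j + 1 + n + 1 = j + n + 2 := by omega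
      simp only [eval_add, eval_mul, eval_sub, eval_C, eval_X, e3]
      ring
    rw [Finset.sum_congr rfl fun j _ => h1 j, Finset.sum_add_distrib]
    -- The boundary terms of the shift belong to B-splines that vanish on the interval.
    have h2 : ∑ j ∈ Finset.range M, F (j + 1) = ∑ j ∈ Finset.range M, F j := by
      have := Finset.sum_range_succ' F M
      rw [Finset.sum_range_succ] at this
      have z1 : F M = 0 := by simp [hF, hB0 M (Or.inl hM)]
      have z2 : F 0 = 0 := by simp [hF, hB0 0 (Or.inr (by omega))]
      rw [z1, z2] at this
      simpa using this.symm
    rw [h2, ← Finset.sum_add_distrib]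
    refine Finset.sum_congr rfl fun j _ => ?_
    simp only [hF]
    by_cases h : μ < j ∨ j + (n + 1) ≤ μ
    · have := hB0 j h
      simp only [hB] at this
      simp [hB, this]
    -- The denominators are nonzero because the support contains the interval with index μ.
    · have hlt : s j < s (j + n + 1) :=
        ((hs (show j ≤ μ by omega)).trans_lt hμ).trans_le (hs (by omega))
      have hne : s (j + n + 1) - s j ≠ 0 := by linarith
      have e4 : C ((x - s j) / (s (j + n + 1) - s j)) * (X - C (s (j + n + 1))) +
          C ((s (j + n + 1) - x) / (s (j + n + 1) - s j)) * (X - C (s j)) = X - C x := by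
        refine Polynomial.funext fun y => ?_
        simp only [eval_add, eval_mul, eval_sub, eval_C, eval_X]
        field_simp
        ring
      rw [← e4]
      simp only [C_mul, hB]
      ring

open Polynomial in
/-- The bilinear concomitant `∑ₘ (-1)^m p^{(m)} ψ^{(n-m)}`, a constant for polynomials of degree
at most `n`. -/
noncomputable def concomitant (n : ℕ) (p ψ : ℝ[X]) : ℝ[X] :=
  ∑ m ∈ Finset.range (n + 1), ((-1 : ℝ) ^ m) • (derivative^[m] p * derivative^[n - m] ψ)

open Polynomial in
-- The derivative of the alternating sum telescopes to two terms with an (n+1)-st derivative, which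
-- vanish by the degree bounds.
theorem eval_concomitant_eq {n : ℕ} {p ψ : ℝ[X]} (hp : p.natDegree ≤ n) (hψ : ψ.natDegree ≤ n)
    (x y : ℝ) : (concomitant n p ψ).eval x = (concomitant n p ψ).eval y := by
  have hd : derivative (concomitant n p ψ) = 0 := by
    set a : ℕ → ℝ[X] := fun m => ((-1 : ℝ) ^ m) • (derivative^[m] p * derivative^[n + 1 - m] ψ)
    have : derivative (concomitant n p ψ) = ∑ m ∈ Finset.range (n + 1), (a m - a (m + 1)) := by
      rw [concomitant, derivative_sum]
      refine Finset.sum_congr rfl fun m hm => ?_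
      have hm' : m ≤ n := by simpa [Nat.lt_succ_iff] using hm
      simp only [a, derivative_smul, derivative_mul, ← Function.iterate_succ_apply' derivative]
      rw [show n + 1 - m = (n - m).succ by omega, show n + 1 - (m + 1) = n - m by omega, pow_succ,
        smul_add, add_comm, mul_neg_one, neg_smul, sub_neg_eq_add]
    rw [this, Finset.sum_range_sub']
    simp only [a]
    rw [iterate_derivative_eq_zero (p := p) (x := n + 1) (by omega), Nat.sub_zero,
      iterate_derivative_eq_zero (p := ψ) (x := n + 1) (by omega)]
    simp
  rw [eq_C_of_natDegree_eq_zero (derivative_eq_zero.1 hd)]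
  simp

open Polynomial in
theorem eval_concomitant_X_sub_pow (n : ℕ) (p : ℝ[X]) (x : ℝ) :
    (concomitant n p ((X - C x) ^ n)).eval x = n.factorial * p.eval x := by
  rw [concomitant, eval_finsetSum, Finset.sum_eq_single 0]
  · rw [iterate_derivative_X_sub_pow]
    simp [Nat.descFactorial_self, mul_comm]
  · intro m hm h0
    have hm' : m ≤ n := by simpa [Nat.lt_succ_iff] using hm
    rw [iterate_derivative_X_sub_pow, show n - (n - m) = m by omega]
    simp [h0]
  · simp

open Polynomial in
-- In each term either m < n + 1 - d or n - m < d, so one of the two derivatives vanishes at τ.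
theorem eval_concomitant_eq_zero {n d : ℕ} {p ψ : ℝ[X]} {τ : ℝ}
    (hp : (X - C τ) ^ (n + 1 - d) ∣ p) (hψ : (X - C τ) ^ d ∣ ψ) :
    (concomitant n p ψ).eval τ = 0 := by
  have key : ∀ (k m : ℕ) (q : ℝ[X]), (X - C τ) ^ k ∣ q → m < k →
      (derivative^[m] q).eval τ = 0 := by
    intro k m q hq hm
    have h1 := pow_sub_dvd_iterate_derivative_of_pow_dvd m hq
    have h2 : (X - C τ) ∣ derivative^[m] q := (dvd_pow_self _ (by omega)).trans h1
    exact dvd_iff_isRoot.1 h2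
  rw [concomitant, eval_finsetSum]
  refine Finset.sum_eq_zero fun m hm => ?_
  have hm' : m ≤ n := by simpa [Nat.lt_succ_iff] using hm
  rw [eval_smul, eval_mul]
  by_cases h : m < n + 1 - d
  · rw [key _ m p hp h]; simp
  · rw [key _ (n - m) ψ hψ (by omega)]; simp

open Polynomial in
theorem concomitant_sum_right {ι : Type*} (n : ℕ) (p : ℝ[X]) (S : Finset ι) (a : ι → ℝ)
    (ψ : ι → ℝ[X]) :
    concomitant n p (∑ i ∈ S, C (a i) * ψ i) = ∑ i ∈ S, C (a i) * concomitant n p (ψ i) := by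
  simp only [concomitant, Finset.mul_sum]
  rw [Finset.sum_comm]
  refine Finset.sum_congr rfl fun m _ => ?_
  rw [iterate_derivative_sum, Finset.mul_sum, Finset.smul_sum]
  refine Finset.sum_congr rfl fun i _ => ?_
  rw [iterate_derivative_C_mul, mul_left_comm, mul_smul_comm]

open Polynomial in
theorem concomitant_sub_left (n : ℕ) (p q ψ : ℝ[X]) :
    concomitant n (p - q) ψ = concomitant n p ψ - concomitant n q ψ := by
  simp only [concomitant, iterate_derivative_sub, sub_mul, smul_sub, Finset.sum_sub_distrib]

open Polynomial in
/-- The de Boor–Fix functional. -/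
noncomputable def dualFunctional (s : ℕ → ℝ) (n j : ℕ) (p : ℝ[X]) : ℝ :=
  (concomitant n p (dualPoly s n j)).eval 0 / n.factorial

open Polynomial in
theorem natDegree_dualPoly (s : ℕ → ℝ) (n j : ℕ) : (dualPoly s n j).natDegree = n := by
  rw [dualPoly, natDegree_prod_of_monic _ _ fun i _ => monic_X_sub_C _]
  simp

open Polynomial in
-- The base point 0 in the definition is arbitrary; later arguments move it to a knot, to an
-- interval endpoint or to the point of evaluation.
theorem dualFunctional_eq (s : ℕ → ℝ) {n : ℕ} (j : ℕ) {p : ℝ[X]} (hp : p.natDegree ≤ n) (τ : ℝ) :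
    dualFunctional s n j p = (concomitant n p (dualPoly s n j)).eval τ / n.factorial := by
  rw [dualFunctional, eval_concomitant_eq hp (natDegree_dualPoly s n j).le 0 τ]

open Polynomial in
-- Pair both sides of `marsden` with p and evaluate at x: the right side becomes n! p(x), since
-- lower derivatives of (X - x)^n vanish at x.
theorem sum_dualFunctional_mul_bsplinePoly {s : ℕ → ℝ} (hs : Monotone s) {μ n M : ℕ}
    (hμ : s μ < s (μ + 1)) (hM : μ < M) (hn : n ≤ μ) {p : ℝ[X]} (hp : p.natDegree ≤ n) :
    ∑ j ∈ Finset.range M, C (dualFunctional s n j p) * bsplinePoly s μ (n + 1) j = p := by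
  refine Polynomial.funext fun x => ?_
  have h := congrArg (fun ψ => (concomitant n p ψ).eval x) (marsden hs hμ x hM n hn)
  simp only [eval_concomitant_X_sub_pow, concomitant_sum_right, eval_finsetSum, eval_mul,
    eval_C] at h
  have hf : (n.factorial : ℝ) ≠ 0 := by positivity
  simp only [eval_finsetSum, eval_mul, eval_C, dualFunctional_eq s _ hp x]
  rw [← mul_right_inj' hf, ← h, Finset.mul_sum]
  refine Finset.sum_congr rfl fun j _ => ?_
  field_simp

open Polynomial in
theorem dualFunctional_one (s : ℕ → ℝ) (n j : ℕ) : dualFunctional s n j 1 = 1 := by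
  rw [dualFunctional, concomitant, Finset.sum_eq_single 0]
  · have h := natDegree_dualPoly s n j
    have hmon : (dualPoly s n j).Monic := monic_prod_of_monic _ _ fun i _ => monic_X_sub_C _
    have := coeff_iterate_derivative (p := dualPoly s n j) (k := n) (m := 0)
    rw [zero_add, Nat.descFactorial_self] at this
    have hc : (dualPoly s n j).coeff n = 1 := by
      have := hmon.coeff_natDegree
      rwa [h] at this
    rw [hc] at this
    have hf : (n.factorial : ℝ) ≠ 0 := by positivity
    simp [← coeff_zero_eq_eval_zero, this, hf]
  · intro m _ hm
    rw [iterate_derivative_eq_zero (p := (1 : ℝ[X])) (by rw [natDegree_one]; omega)]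
    simp
  · simp

theorem sum_bspline_eq_one {s : ℕ → ℝ} (hs : Monotone s) {μ n M : ℕ}
    (hM : μ < M) (hn : n ≤ μ) {x : ℝ} (hx : x ∈ Ico (s μ) (s (μ + 1))) :
    ∑ j ∈ Finset.range M, bspline s (n + 1) j x = 1 := by
  have h := sum_dualFunctional_mul_bsplinePoly hs (hx.1.trans_lt hx.2) hM hn
    (p := 1) (by simp)
  have h' := congrArg (Polynomial.eval x) h
  simp only [dualFunctional_one, Polynomial.eval_finsetSum, map_one, one_mul,
    Polynomial.eval_one] at h'
  rw [← h']
  exact Finset.sum_congr rfl fun j _ => bspline_eq_eval hs hx _ _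

/-! ### Smoothness of piecewise polynomials -/

open Polynomial in
theorem X_sub_C_pow_dvd_of_forall_eval {p : ℝ[X]} {τ : ℝ} {n : ℕ}
    (h : ∀ m ≤ n, (derivative^[m] p).eval τ = 0) : (X - C τ) ^ (n + 1) ∣ p := by
  rcases eq_or_ne p 0 with rfl | h0
  · exact dvd_zero _
  · rw [← le_rootMultiplicity_iff h0]
    exact lt_rootMultiplicity_of_isRoot_iterate_derivative h0 h

open Polynomial in
-- Induction on m: the derivative of the glued function is the gluing of the derivatives, whose
-- difference loses one factor X - τ.
theorem contDiff_piecewise_polynomial (m : ℕ) {τ : ℝ} : ∀ {p q : ℝ[X]},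
    (X - C τ) ^ (m + 1) ∣ q - p →
    ContDiff ℝ m (fun x => if x < τ then p.eval x else q.eval x) := by
  have hcont : ∀ p q : ℝ[X], (X - C τ) ∣ q - p →
      Continuous (fun x => if x < τ then p.eval x else q.eval x) := by
    intro p q h
    have h0 : q.eval τ = p.eval τ := by
      have := dvd_iff_isRoot.1 h
      simpa [sub_eq_zero] using this
    have e : (fun x => if x < τ then p.eval x else q.eval x) =
        fun x => if τ ≤ x then q.eval x else p.eval x := by
      funext x
      by_cases hx : x < τ
      · simp [hx, not_le.2 hx]
      · simp [hx, not_lt.1 hx]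
    rw [e]
    refine Continuous.if_le q.continuous p.continuous continuous_const continuous_id ?_
    rintro x rfl
    exact h0
  induction m with
  | zero =>
    intro p q h
    exact contDiff_zero.2 (hcont p q (by simpa using h))
  | succ m ih =>
    intro p q h
    have h' : (X - C τ) ^ (m + 1) ∣ derivative q - derivative p := by
      have := pow_sub_one_dvd_derivative_of_pow_dvd h
      simpa [derivative_sub] using this
    have hd : ∀ x, HasDerivAt (fun x => if x < τ then p.eval x else q.eval x)
        ((fun x => if x < τ then (derivative p).eval x else (derivative q).eval x) x) x := by
      have hne : ∀ x, x ≠ τ → HasDerivAt (fun x => if x < τ then p.eval x else q.eval x)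
          ((fun x => if x < τ then (derivative p).eval x else (derivative q).eval x) x) x := by
        intro x hx
        rcases lt_or_gt_of_ne hx with hlt | hgt
        · simp only [hlt, if_true]
          refine (p.hasDerivAt x).congr_of_eventuallyEq ?_
          filter_upwards [Iio_mem_nhds hlt] with y hy
          simp [mem_Iio.1 hy]
        · simp only [not_lt.2 hgt.le, if_false]
          refine (q.hasDerivAt x).congr_of_eventuallyEq ?_
          filter_upwards [Ioi_mem_nhds hgt] with y hy
          simp [not_lt.2 (mem_Ioi.1 hy).le]
      intro x
      by_cases hx : x = τ
      · subst hx
        -- At the knot itself the derivative is the limit of the derivatives nearby.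
        exact hasDerivAt_of_hasDerivAt_of_ne hne
          (hcont p q ((dvd_pow_self _ (by omega)).trans h)).continuousAt
          (hcont _ _ ((dvd_pow_self _ (by omega)).trans h')).continuousAt
      · exact hne x hx
    push_cast
    rw [contDiff_succ_iff_deriv]
    refine ⟨fun x => (hd x).differentiableAt, by simp, ?_⟩
    rw [show deriv (fun x => if x < τ then p.eval x else q.eval x) = _ from
      funext fun x => (hd x).deriv]
    exact ih h'

open Polynomial in
theorem contDiffAt_piecewise_polynomial {m : ℕ} {a b τ : ℝ} {p q : ℝ[X]} {f : ℝ → ℝ}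
    (ha : a < τ) (hb : τ < b) (hp : ∀ x ∈ Ioo a τ, f x = p.eval x)
    (hq : ∀ x ∈ Ico τ b, f x = q.eval x) (h : (X - C τ) ^ (m + 1) ∣ q - p) :
    ContDiffAt ℝ m f τ := by
  refine (contDiff_piecewise_polynomial m h).contDiffAt.congr_of_eventuallyEq ?_
  filter_upwards [Ioo_mem_nhds ha hb] with x hx
  by_cases hlt : x < τ
  · simp [hlt, hp x ⟨hx.1, hlt⟩]
  · simp [hlt, hq x ⟨not_lt.1 hlt, hx.2⟩]

open Polynomial in
theorem eval_iterate_derivative_eq_of_contDiffAt {a b τ : ℝ} (ha : a < τ) (hb : τ < b) (m : ℕ) :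
    ∀ {p q : ℝ[X]} {f : ℝ → ℝ}, ContDiffAt ℝ m f τ → (∀ x ∈ Ioo a τ, f x = p.eval x) →
    (∀ x ∈ Ioo τ b, f x = q.eval x) →
    (derivative^[m] p).eval τ = (derivative^[m] q).eval τ := by
  induction m with
  | zero =>
    intro p q f hf hp hq
    have hc : ContinuousAt f τ := hf.continuousAt
    have key : ∀ (S : Set ℝ) (u : ℝ[X]), (𝓝[S] τ).NeBot → (∀ᶠ x in 𝓝[S] τ, f x = u.eval x) →
        f τ = u.eval τ := by
      intro S u hS hu
      refine tendsto_nhds_unique (hc.mono_left (nhdsWithin_le_nhds (s := S))) ?_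
      refine Tendsto.congr' (hu.mono fun x hx => hx.symm) ?_
      exact u.continuous.continuousAt.mono_left nhdsWithin_le_nhds
    simp only [Function.iterate_zero, id]
    rw [← key (Iio τ) p inferInstance (by filter_upwards [Ioo_mem_nhdsLT ha] using hp),
      ← key (Ioi τ) q inferInstance (by filter_upwards [Ioo_mem_nhdsGT hb] using hq)]
  | succ m ih =>
    intro p q f hf hp hq
    rw [Function.iterate_succ_apply, Function.iterate_succ_apply]
    have hd : ∀ (c d : ℝ) (u : ℝ[X]), (∀ x ∈ Ioo c d, f x = u.eval x) →
        ∀ x ∈ Ioo c d, deriv f x = (derivative u).eval x := by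
      intro c d u hu x hx
      rw [Filter.EventuallyEq.deriv_eq (f := fun x => u.eval x), u.deriv]
      filter_upwards [Ioo_mem_nhds hx.1 hx.2] using hu
    exact ih (hf.derivWithin (by push_cast; rfl)) (hd _ _ _ hp) (hd _ _ _ hq)

open Polynomial in
theorem X_sub_C_pow_dvd_of_contDiffAt {m : ℕ} {a b τ : ℝ} {p q : ℝ[X]} {f : ℝ → ℝ}
    (ha : a < τ) (hb : τ < b) (hf : ContDiffAt ℝ m f τ) (hp : ∀ x ∈ Ioo a τ, f x = p.eval x)
    (hq : ∀ x ∈ Ioo τ b, f x = q.eval x) : (X - C τ) ^ (m + 1) ∣ p - q := by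
  refine X_sub_C_pow_dvd_of_forall_eval fun k hk => ?_
  rw [iterate_derivative_sub, eval_sub, sub_eq_zero]
  exact eval_iterate_derivative_eq_of_contDiffAt ha hb k (hf.of_le (by exact_mod_cast hk)) hp hq

/-! ### Matching of B-splines across a multiple knot -/

open Polynomial in
-- The bounds on j say that all d copies of τ are among the n roots s_{j+1}, …, s_{j+n}.
theorem X_sub_C_pow_dvd_dualPoly {s : ℕ → ℝ} {μ n d j : ℕ} {τ : ℝ}
    (hτ : ∀ i < d, s (μ + 1 + i) = τ) (hj : j ≤ μ) (hjn : μ + d ≤ j + n) :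
    (X - C τ) ^ d ∣ dualPoly s n j := by
  have h : (X - C τ) ^ d = ∏ i ∈ Finset.Ico (μ - j) (μ - j + d), (X - C (s (j + 1 + i))) := by
    rw [Finset.prod_congr rfl (g := fun _ => X - C τ), Finset.prod_const, Nat.card_Ico]
    · congr 1; omega
    · intro i hi
      rw [Finset.mem_Ico] at hi
      rw [← hτ (i - (μ - j)) (by omega)]
      congr 3
      omega
  rw [h, dualPoly]
  refine Finset.prod_dvd_prod_of_subset _ _ _ fun i hi => ?_
  rw [Finset.mem_Ico] at hi
  rw [Finset.mem_range]
  omega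

open Polynomial in
theorem dualFunctional_eq_of_dvd {s : ℕ → ℝ} {μ n d j : ℕ} {τ : ℝ}
    (hτ : ∀ i < d, s (μ + 1 + i) = τ) (hj : j ≤ μ) (hjn : μ + d ≤ j + n) {p q : ℝ[X]}
    (hp : p.natDegree ≤ n) (hq : q.natDegree ≤ n) (h : (X - C τ) ^ (n + 1 - d) ∣ p - q) :
    dualFunctional s n j p = dualFunctional s n j q := by
  rw [dualFunctional_eq s j hp τ, dualFunctional_eq s j hq τ]
  congr 1
  rw [← sub_eq_zero, ← eval_sub, ← concomitant_sub_left]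
  exact eval_concomitant_eq_zero h (X_sub_C_pow_dvd_dualPoly hτ hj hjn)

open Polynomial in
theorem natDegree_le_iff_mem_degreeLT {n : ℕ} {p : ℝ[X]} :
    p.natDegree ≤ n ↔ p ∈ degreeLT ℝ (n + 1) := by
  rw [mem_degreeLT, degree_lt_iff_coeff_zero, natDegree_le_iff_coeff_eq_zero]
  rfl

open Polynomial in
-- A dimension count in place of differentiating the recursion. The pairs (p, q) of degree at most n
-- with (X - τ)^{n+1-d} ∣ q - p form a space of dimension n + 1 + d, parametrized by `L`. By the de
-- Boor–Fix expansion it lies in the span of the pairs of pieces of the n + 1 + d B-splines that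
-- live on either interval. The two spaces therefore coincide, so every pair of pieces matches.
theorem X_sub_C_pow_dvd_bsplinePoly_sub {s : ℕ → ℝ} (hs : Monotone s) {μ n d : ℕ} {τ : ℝ}
    (hn : n ≤ μ) (hd : d ≤ n + 1) (hμ : s μ < s (μ + 1)) (hτ : ∀ i < d, s (μ + 1 + i) = τ)
    (hμ' : s (μ + d) < s (μ + d + 1)) (j : ℕ) :
    (X - C τ) ^ (n + 1 - d) ∣ bsplinePoly s (μ + d) (n + 1) j - bsplinePoly s μ (n + 1) j := by
  set B : ℕ → ℝ[X] := bsplinePoly s μ (n + 1) with hB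
  set B' : ℕ → ℝ[X] := bsplinePoly s (μ + d) (n + 1) with hB'
  have z : ∀ j, μ < j ∨ j + (n + 1) ≤ μ → B j = 0 := bsplinePoly_eq_zero s μ (n + 1)
  have z' : ∀ j, μ + d < j ∨ j + (n + 1) ≤ μ + d → B' j = 0 :=
    bsplinePoly_eq_zero s (μ + d) (n + 1)
  let L : (degreeLT ℝ (n + 1) × degreeLT ℝ d) →ₗ[ℝ] ℝ[X] × ℝ[X] :=
    { toFun := fun u => ((u.1 : ℝ[X]), (u.1 : ℝ[X]) + (X - C τ) ^ (n + 1 - d) * (u.2 : ℝ[X]))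
      map_add' := fun u v => by ext1 <;> simp; ring
      map_smul' := fun c u => by ext1 <;> simp [smul_eq_C_mul]; ring }
  have hL : Function.Injective L := by
    rw [← LinearMap.ker_eq_bot, LinearMap.ker_eq_bot']
    rintro ⟨u, v⟩ h
    have h1 : (u : ℝ[X]) = 0 := congrArg Prod.fst h
    have h2 : (u : ℝ[X]) + (X - C τ) ^ (n + 1 - d) * (v : ℝ[X]) = 0 := congrArg Prod.snd h
    rw [h1, zero_add] at h2
    have h3 : (v : ℝ[X]) = 0 :=
      (mul_eq_zero.1 h2).resolve_left (pow_ne_zero _ (X_sub_C_ne_zero τ))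
    ext1
    · exact Subtype.ext h1
    · exact Subtype.ext h3
  classical
  set S : Finset (ℝ[X] × ℝ[X]) := (Finset.Ico (μ - n) (μ + d + 1)).image fun j => (B j, B' j)
    with hS
  have hmem : ∀ j, (B j, B' j) ∈ Submodule.span ℝ (S : Set (ℝ[X] × ℝ[X])) := by
    intro j
    by_cases hj : j ∈ Finset.Ico (μ - n) (μ + d + 1)
    · exact Submodule.subset_span (Finset.mem_coe.2 (Finset.mem_image_of_mem _ hj))
    · rw [Finset.mem_Ico] at hj
      rw [z j (by omega), z' j (by omega)]
      exact Submodule.zero_mem _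
  have hdeg : ∀ g : degreeLT ℝ d, ((X - C τ) ^ (n + 1 - d) * (g : ℝ[X])) ∈ degreeLT ℝ (n + 1) := by
    rintro ⟨g, hg⟩
    rcases eq_or_ne g 0 with rfl | h0
    · simp
    · rw [mem_degreeLT] at hg ⊢
      simp only [degree_mul, degree_pow, degree_X_sub_C]
      rw [degree_eq_natDegree h0] at hg ⊢
      simp only [nsmul_eq_mul, mul_one]
      norm_cast at hg ⊢
      omega
  have hle : LinearMap.range L ≤ Submodule.span ℝ (S : Set (ℝ[X] × ℝ[X])) := by
    rintro _ ⟨⟨u, v⟩, rfl⟩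
    set p : ℝ[X] := (u : ℝ[X]) with hp
    set q : ℝ[X] := (u : ℝ[X]) + (X - C τ) ^ (n + 1 - d) * (v : ℝ[X]) with hq
    have hpn : p.natDegree ≤ n := natDegree_le_iff_mem_degreeLT.2 u.2
    have hqn : q.natDegree ≤ n :=
      natDegree_le_iff_mem_degreeLT.2 (Submodule.add_mem _ u.2 (hdeg v))
    have hdvd : (X - C τ) ^ (n + 1 - d) ∣ p - q := by
      rw [hp, hq, sub_add_cancel_left, dvd_neg]
      exact dvd_mul_right _ _
    -- One coefficient must serve both intervals. For j ≤ μ either the B-spline vanishes on the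
    -- right interval or the functionals of p and q agree; for j > μ it vanishes on the left one.
    set a : ℕ → ℝ := fun j => if j ≤ μ then dualFunctional s n j p else dualFunctional s n j q
    have e : L (u, v) = ∑ j ∈ Finset.range (μ + d + 1), a j • (B j, B' j) := by
      have e1 : L (u, v) = (p, q) := rfl
      rw [e1]
      ext1
      · rw [Prod.fst_sum]
        dsimp only
        conv_lhs => rw [← sum_dualFunctional_mul_bsplinePoly hs hμ
          (show μ < μ + d + 1 by omega) hn hpn]
        refine Finset.sum_congr rfl fun j _ => ?_
        rw [Prod.smul_fst, smul_eq_C_mul]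
        by_cases hj : j ≤ μ
        · simp [a, hj, hB]
        · rw [← hB, z j (by omega)]; simp
      · rw [Prod.snd_sum]
        dsimp only
        conv_lhs => rw [← sum_dualFunctional_mul_bsplinePoly hs hμ'
          (show μ + d < μ + d + 1 by omega) (by omega) hqn]
        refine Finset.sum_congr rfl fun j _ => ?_
        rw [Prod.smul_snd, smul_eq_C_mul]
        by_cases hj : j ≤ μ
        · by_cases hj' : j + (n + 1) ≤ μ + d
          · rw [← hB', z' j (by omega)]; simp
          · simp only [a, hj, if_true, hB']
            rw [dualFunctional_eq_of_dvd hτ hj (by omega) hpn hqn hdvd]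
        · simp [a, hj, hB']
    rw [e]
    exact Submodule.sum_mem _ fun j _ => Submodule.smul_mem _ _ (hmem j)
  have hfin : Module.finrank ℝ (Submodule.span ℝ (S : Set (ℝ[X] × ℝ[X]))) ≤
      Module.finrank ℝ (LinearMap.range L) := by
    rw [LinearMap.finrank_range_of_inj hL, Module.finrank_prod,
      (degreeLTEquiv ℝ (n + 1)).finrank_eq, (degreeLTEquiv ℝ d).finrank_eq]
    refine (finrank_span_finset_le_card S).trans (Finset.card_image_le.trans ?_)
    simp
    omega
  have heq := Submodule.eq_of_le_of_finrank_le hle hfin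
  have := hmem j
  rw [← heq] at this
  obtain ⟨⟨u, v⟩, huv⟩ := this
  have h1 : (u : ℝ[X]) = B j := congrArg Prod.fst huv
  have h2 : (u : ℝ[X]) + (X - C τ) ^ (n + 1 - d) * (v : ℝ[X]) = B' j := congrArg Prod.snd huv
  rw [← h2, ← h1, add_sub_cancel_left]
  exact dvd_mul_right _ _

open Polynomial in
-- Local linear independence: the n + 1 B-splines that live on the interval span the polynomials of
-- degree at most n, a space of dimension n + 1.
theorem coeff_eq_zero_of_sum_bsplinePoly_eq_zero {s : ℕ → ℝ} (hs : Monotone s) {μ n M : ℕ}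
    (hn : n ≤ μ) (hM : μ < M) (hμ : s μ < s (μ + 1)) {a : ℕ → ℝ}
    (h : ∑ j ∈ Finset.range M, C (a j) * bsplinePoly s μ (n + 1) j = 0) {j : ℕ}
    (hj : μ ≤ j + n) (hj' : j ≤ μ) : a j = 0 := by
  set B : ℕ → ℝ[X] := bsplinePoly s μ (n + 1) with hB
  have z : ∀ j, μ < j ∨ j + (n + 1) ≤ μ → B j = 0 := bsplinePoly_eq_zero s μ (n + 1)
  have hsum : ∀ b : ℕ → ℝ, ∑ j ∈ Finset.range M, C (b j) * B j =
      ∑ i : Fin (n + 1), b (μ - n + i) • B (μ - n + i) := by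
    intro b
    rw [Fin.sum_univ_eq_sum_range (fun i => b (μ - n + i) • B (μ - n + i)) (n + 1)]
    have e := Finset.sum_Ico_eq_sum_range (fun j => C (b j) * B j) (μ - n) (μ + 1)
    rw [show μ + 1 - (μ - n) = n + 1 by omega] at e
    simp only [smul_eq_C_mul]
    rw [← e]
    symm
    refine Finset.sum_subset (fun i hi => ?_) fun i _ hi => ?_
    · rw [Finset.mem_Ico] at hi; rw [Finset.mem_range]; omega
    · rw [Finset.mem_Ico] at hi
      rw [z i (by omega), mul_zero]
  let T : (Fin (n + 1) → ℝ) →ₗ[ℝ] degreeLT ℝ (n + 1) :=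
    (Fintype.linearCombination ℝ fun i : Fin (n + 1) =>
      (⟨B (μ - n + i), mem_degreeLT.2 (bsplinePoly_degree_lt s μ (n + 1) _)⟩ :
        degreeLT ℝ (n + 1)))
  have hT : ∀ b, ((T b : degreeLT ℝ (n + 1)) : ℝ[X]) = ∑ i, b i • B (μ - n + i) := by
    intro b
    simp [T, Fintype.linearCombination_apply]
  have hsurj : Function.Surjective T := by
    rintro ⟨p, hp⟩
    refine ⟨fun i => dualFunctional s n (μ - n + i) p, Subtype.ext ?_⟩
    rw [hT, ← hsum fun j => dualFunctional s n j p]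
    exact sum_dualFunctional_mul_bsplinePoly hs hμ hM hn (natDegree_le_iff_mem_degreeLT.2 hp)
  have hinj : Function.Injective T := by
    rw [LinearMap.injective_iff_surjective_of_finrank_eq_finrank]
    · exact hsurj
    · rw [(degreeLTEquiv ℝ (n + 1)).finrank_eq]
  have h0 : (fun i : Fin (n + 1) => a (μ - n + i)) = 0 := by
    apply hinj
    rw [map_zero]
    refine Subtype.ext ?_
    rw [hT, ← hsum a, h]
    rfl
  have := congrFun h0 ⟨j - (μ - n), by omega⟩
  simpa [show μ - n + (j - (μ - n)) = j by omega] using this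

/-! ### The basic knots -/

/-- The index of the augmented knot that is the `m`-th basic knot. -/
def basicIndex (r d l m : ℕ) : ℤ :=
  if m < r then (m : ℤ) - r + 1
  else if m < r + l * d then 1 + ((m - r) / d : ℕ)
  else (l : ℤ) + 1 + (m - (r + l * d) : ℕ)

theorem basicKnots_eq (r d l : ℕ) (t : ℤ → ℝ) (m : ℕ) :
    basicKnots r d l t m = t (basicIndex r d l m) := by
  unfold basicKnots basicIndex
  split_ifs <;> rfl

theorem basicIndex_le_succ {r d l : ℕ} (hd : 1 ≤ d) (m : ℕ) :
    basicIndex r d l m ≤ basicIndex r d l (m + 1) := by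
  unfold basicIndex
  have h1 : (m - r) / d ≤ (m + 1 - r) / d := Nat.div_le_div_right (by omega)
  have h2 : m < r + l * d → r ≤ m → (m - r) / d < l := fun h h' => by
    rw [Nat.div_lt_iff_lt_mul (by omega)]; omega
  generalize (m - r) / d = u at *
  generalize (m + 1 - r) / d = v at *
  split_ifs <;> omega

theorem basicIndex_mem {r d l m : ℕ} (hd : 1 ≤ d) (hm : m + 1 ≤ 2 * r + l * d) :
    -(r : ℤ) + 1 ≤ basicIndex r d l m ∧ basicIndex r d l m ≤ l + r := by
  unfold basicIndex
  have h2 : m < r + l * d → r ≤ m → (m - r) / d < l := fun h h' => by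
    rw [Nat.div_lt_iff_lt_mul (by omega)]; omega
  generalize (m - r) / d = u at *
  split_ifs <;> omega

theorem IsAugmentedKnots.le_succ {r l : ℕ} {t : ℤ → ℝ} (h : IsAugmentedKnots r l t) {i : ℤ}
    (hi : -(r : ℤ) + 1 ≤ i) (hi' : i < l + r) : t i ≤ t (i + 1) := by
  by_cases h0 : i < 0
  · exact h.left i hi h0
  · by_cases h1 : i ≤ l
    · exact (h.inner i (by omega) h1).le
    · exact h.right i (by omega) hi'

theorem IsAugmentedKnots.mono {r l : ℕ} {t : ℤ → ℝ} (h : IsAugmentedKnots r l t) {i j : ℤ}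
    (hi : -(r : ℤ) + 1 ≤ i) (hij : i ≤ j) (hj : j ≤ l + r) : t i ≤ t j := by
  induction j, hij using Int.leInduction with
  | base => exact le_rfl
  | succ j hij ih => exact (ih (by omega)).trans (h.le_succ (by omega) (by omega))

/-- The relation between an augmented knot sequence `t` and a monotone sequence `s` that starts
with its basic knots, for the order `n + 1`. -/
structure KnotLayout (n d l : ℕ) (t : ℤ → ℝ) (s : ℕ → ℝ) : Prop where
  mono : Monotone s
  agree : ∀ m, m < 2 * (n + 1) + l * d → s m = basicKnots (n + 1) d l t m
  left : ∀ i ≤ l, s (n + i * d) = t i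
  right : ∀ i ≤ l, s (n + i * d + 1) = t (i + 1)
  mult : ∀ i < l, ∀ e < d, s (n + i * d + 1 + e) = t (i + 1)
  lt : ∀ i : ℕ, i ≤ l → t i < t (i + 1)

theorem IsAugmentedKnots.exists_layout {n d l : ℕ} (hd : 1 ≤ d) {t : ℤ → ℝ}
    (h : IsAugmentedKnots (n + 1) l t) : ∃ s, KnotLayout n d l t s := by
  have hmult : ∀ i < l, ∀ e < d, basicIndex (n + 1) d l (n + i * d + 1 + e) = i + 1 := by
    intro i hi e he
    have h1 : (i + 1) * d ≤ l * d := Nat.mul_le_mul_right d hi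
    rw [add_mul, one_mul] at h1
    have h2 : (n + i * d + 1 + e - (n + 1)) / d = i := by
      rw [show n + i * d + 1 + e - (n + 1) = e + i * d by omega, Nat.add_mul_div_right _ _ (by omega),
        Nat.div_eq_of_lt he, zero_add]
    unfold basicIndex
    rw [h2, if_neg (by omega), if_pos (by omega)]
    omega
  have hright : ∀ i ≤ l, basicIndex (n + 1) d l (n + i * d + 1) = i + 1 := by
    intro i hi
    rcases hi.lt_or_eq with hi | rfl
    · exact hmult i hi 0 (by omega)
    · unfold basicIndex
      rw [if_neg (by omega), if_neg (by omega), show n + i * d + 1 - (n + 1 + i * d) = 0 by omega]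
      simp
  have hleft : ∀ i ≤ l, basicIndex (n + 1) d l (n + i * d) = i := by
    intro i hi
    cases i with
    | zero => simp [basicIndex]
    | succ i =>
      have := hmult i (by omega) (d - 1) (by omega)
      rw [show n + i * d + 1 + (d - 1) = n + (i + 1) * d by rw [add_mul]; omega] at this
      rw [this]
      push_cast
      ring
  -- The index of the last basic knot. Freezing the sequence there makes it monotone on all of `ℕ`,
  -- without any assumption on later values of `t`.
  set N := 2 * (n + 1) + l * d - 1 with hN
  have hmono : ∀ i ≤ l, i * d ≤ l * d := fun i hi => Nat.mul_le_mul_right d hi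
  have hagree : ∀ m, m < 2 * (n + 1) + l * d →
      basicKnots (n + 1) d l t (min m N) = t (basicIndex (n + 1) d l m) := fun m hm => by
    rw [min_eq_left (by omega), basicKnots_eq]
  refine ⟨fun m => basicKnots (n + 1) d l t (min m N), ?_, ?_, ?_, ?_, ?_, ?_⟩
  · refine monotone_nat_of_le_succ fun m => ?_
    by_cases hm : m + 1 ≤ N
    · rw [min_eq_left hm, min_eq_left (by omega), basicKnots_eq, basicKnots_eq]
      exact h.mono (basicIndex_mem hd (by omega)).1 (basicIndex_le_succ hd m)
        (basicIndex_mem hd (by omega)).2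
    · rw [min_eq_right (by omega : N ≤ m), min_eq_right (by omega : N ≤ m + 1)]
  · intro m hm
    rw [hagree m hm, basicKnots_eq]
  · intro i hi
    have := hmono i hi
    rw [hagree _ (by omega), hleft i hi]
  · intro i hi
    have := hmono i hi
    rw [hagree _ (by omega), hright i hi]
  · intro i hi e he
    have := hmono (i + 1) hi
    rw [add_mul] at this
    rw [hagree _ (by omega), hmult i hi e he]
  · intro i hi
    exact h.inner i (by omega) (by omega)

section KnotLayout

variable {n d l : ℕ} {t : ℤ → ℝ} {s : ℕ → ℝ}

theorem KnotLayout.splineBasis_eq (h : KnotLayout n d l t s) {j : ℕ} (hj : j < n + 1 + l * d) :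
    splineBasis (n + 1) d l t j = bspline s (n + 1) j :=
  bspline_congr _ _ fun m _ hm => (h.agree m (by omega)).symm

theorem KnotLayout.gap_pos (h : KnotLayout n d l t s) {i : ℕ} (hi : i ≤ l) :
    s (n + i * d) < s (n + i * d + 1) := by
  rw [h.left i hi, h.right i hi]
  exact h.lt i hi

theorem KnotLayout.Ico_eq (h : KnotLayout n d l t s) {i : ℕ} (hi : i ≤ l) :
    Ico (t i) (t (i + 1)) = Ico (s (n + i * d)) (s (n + i * d + 1)) := by
  rw [h.left i hi, h.right i hi]

/-- The index windows [id, id + n] leave no holes since d ≤ n + 1. Hence every B-spline has a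
nondegenerate interior knot interval in its support. -/
theorem exists_interval_index {n d l j : ℕ} (hd : d ≤ n + 1) (hj : j < n + 1 + l * d) :
    ∃ i ≤ l, i * d ≤ j ∧ j ≤ i * d + n := by
  induction l with
  | zero => exact ⟨0, le_rfl, by omega, by omega⟩
  | succ l ih =>
    by_cases h : j < n + 1 + l * d
    · obtain ⟨i, hi, h1, h2⟩ := ih h
      exact ⟨i, by omega, h1, h2⟩
    · exact ⟨l + 1, le_rfl, by rw [add_mul] at hj ⊢; omega, by omega⟩

/-- Divide m - n by d: remainder 0 gives the last copy of a knot, any other remainder a step between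
two copies. -/
theorem KnotLayout.inner_gap (h : KnotLayout n d l t s) (hd : 1 ≤ d) {m : ℕ} (hm : n ≤ m)
    (hm' : m < n + 1 + l * d) :
    (∃ i ≤ l, m = n + i * d) ∨ s m = s (m + 1) := by
  obtain ⟨q, e, he, hq⟩ : ∃ q e, e < d ∧ m = n + q * d + e :=
    ⟨(m - n) / d, (m - n) % d, Nat.mod_lt _ hd, by
      have := Nat.div_add_mod (m - n) d
      rw [mul_comm] at this
      omega⟩
  rcases Nat.eq_zero_or_pos e with rfl | h0
  · left
    refine ⟨q, ?_, by omega⟩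
    by_contra hlt
    have := Nat.mul_le_mul_right d (show l + 1 ≤ q by omega)
    rw [add_mul] at this
    omega
  · right
    have hql : q < l := by
      by_contra hlt
      have := Nat.mul_le_mul_right d (show l ≤ q by omega)
      omega
    have e1 := h.mult q hql (e - 1) (by omega)
    have e2 := h.mult q hql e he
    rw [show n + q * d + 1 + (e - 1) = m by omega] at e1
    rw [show n + q * d + 1 + e = m + 1 by omega] at e2
    rw [e1, e2]

theorem KnotLayout.gap_le_length (h : KnotLayout n d l t s) {i j : ℕ} (hi : i ≤ l)
    (h1 : i * d ≤ j) (h2 : j ≤ i * d + n) : t (i + 1) - t i ≤ s (j + (n + 1)) - s j := by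
  rw [← h.left i hi, ← h.right i hi]
  have := h.mono (show j ≤ n + i * d by omega)
  have := h.mono (show n + i * d + 1 ≤ j + (n + 1) by omega)
  linarith

/-- Take the longest interior interval in the support. Each of the n + 1 basic knot steps is an
interior interval, zero, or an outer step dominated by the first or last interior interval; summing
gives the factor n + 1. -/
theorem KnotLayout.exists_long_gap (h : KnotLayout n d l t s) (hd : 1 ≤ d) (hdn : d ≤ n + 1)
    (ho : OuterKnotsControlled (n + 1) l t) {j : ℕ} (hj : j < n + 1 + l * d) :
    ∃ i ≤ l, i * d ≤ j ∧ j ≤ i * d + n ∧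
      s (j + (n + 1)) - s j ≤ ((n + 1 : ℕ) : ℝ) * (t (i + 1) - t i) := by
  classical
  obtain ⟨i₀, hi₀, h1, h2⟩ := exists_interval_index hdn hj
  set S := (Finset.range (l + 1)).filter fun i => i * d ≤ j ∧ j ≤ i * d + n with hS
  have hne : S.Nonempty := ⟨i₀, by simp [hS]; omega⟩
  obtain ⟨i, hi, hmax⟩ := S.exists_max_image (fun i : ℕ => t (i + 1) - t i) hne
  simp only [hS, Finset.mem_filter, Finset.mem_range] at hi hmax
  refine ⟨i, by omega, hi.2.1, hi.2.2, ?_⟩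
  have hgap : ∀ e ∈ Finset.range (n + 1), s (j + (e + 1)) - s (j + e) ≤ t (i + 1) - t i := by
    intro e he
    rw [Finset.mem_range] at he
    have hp := h.lt i (by omega)
    rcases lt_or_ge (j + e) n with hm | hm
    -- A step left of 0 occurs only if j < n, and then the first interior interval competes in the
    -- maximum.
    · have h0 := hmax 0 ⟨by omega, by omega, by omega⟩
      rw [h.agree (j + e) (by omega), h.agree (j + (e + 1)) (by omega), basicKnots_eq,
        basicKnots_eq]
      have e1 : basicIndex (n + 1) d l (j + e) = ((j + (e + 1) : ℕ) : ℤ) - (n + 1 : ℕ) + 1 - 1 := by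
        unfold basicIndex; rw [if_pos (by omega)]; omega
      have e2 : basicIndex (n + 1) d l (j + (e + 1)) =
          ((j + (e + 1) : ℕ) : ℤ) - (n + 1 : ℕ) + 1 := by
        unfold basicIndex; rw [if_pos (by omega)]
      rw [e1, e2]
      have := ho.left (((j + (e + 1) : ℕ) : ℤ) - (n + 1 : ℕ) + 1) (by omega) (by omega)
      simp only [Nat.cast_zero, zero_add] at h0
      linarith
    · rcases lt_or_ge (j + e) (n + 1 + l * d) with hm' | hm'
      · rcases h.inner_gap hd hm hm' with ⟨i', hi', e1⟩ | e1
        · rw [← add_assoc, e1, h.left i' hi', h.right i' hi']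
          exact hmax i' ⟨by omega, by omega, by omega⟩
        · rw [← add_assoc, ← e1]; linarith
      · have h0 := hmax l ⟨by omega, by omega, by omega⟩
        rw [h.agree (j + e) (by omega), h.agree (j + (e + 1)) (by omega), basicKnots_eq,
          basicKnots_eq]
        have e1 : basicIndex (n + 1) d l (j + e) = (l : ℤ) + 1 + (j + e - (n + 1 + l * d) : ℕ) := by
          unfold basicIndex; rw [if_neg (by omega), if_neg (by omega)]
        have e2 : basicIndex (n + 1) d l (j + (e + 1)) =
            (l : ℤ) + 1 + (j + e - (n + 1 + l * d) : ℕ) + 1 := by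
          unfold basicIndex; rw [if_neg (by omega), if_neg (by omega)]; omega
        rw [e1, e2]
        have := ho.right ((l : ℤ) + 1 + (j + e - (n + 1 + l * d) : ℕ)) (by omega) (by omega)
        linarith
  have := Finset.sum_le_sum hgap
  rw [Finset.sum_range_sub (fun e => s (j + e)), Finset.sum_const, Finset.card_range,
    nsmul_eq_mul, add_zero] at this
  exact this

theorem KnotLayout.endpoints (h : KnotLayout n d l t s) (ht : IsAugmentedKnots (n + 1) l t) :
    s n = 0 ∧ s (n + 1 + l * d) = 1 := by
  constructor
  · have := h.left 0 (by omega)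
    simpa [ht.zero] using this
  · have := h.right l le_rfl
    rw [ht.one] at this
    rw [← this]
    congr 1
    omega

theorem KnotLayout.abs_sub_le (h : KnotLayout n d l t s) (hd : 1 ≤ d)
    (ht : IsAugmentedKnots (n + 1) l t) {δ : ℝ}
    (hδ : ∀ i : ℕ, i ≤ l → t (i + 1) - t i ≤ δ) {j : ℕ} {x y : ℝ}
    (hx : x ∈ Icc (s j) (s (j + (n + 1)))) (hx' : x ∈ Icc (0 : ℝ) 1)
    (hy : y ∈ Icc (s j) (s (j + (n + 1)))) (hy' : y ∈ Icc (0 : ℝ) 1) :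
    |x - y| ≤ ((n + 1 : ℕ) : ℝ) * δ := by
  obtain ⟨h0, h1⟩ := h.endpoints ht
  have hδ0 : 0 ≤ δ := (sub_nonneg.2 (h.lt 0 (by omega)).le).trans (hδ 0 (by omega))
  -- The knots are truncated to [0,1] because the outer knots need not be controlled here; outer
  -- steps then have length zero.
  set c : ℕ → ℝ := fun m => max 0 (min 1 (s m)) with hc
  have hgap : ∀ e ∈ Finset.range (n + 1), c (j + (e + 1)) - c (j + e) ≤ δ := by
    intro e _
    simp only [hc]
    rcases lt_or_ge (j + e) n with hm | hm
    · have e1 : s (j + e) ≤ 0 := h0 ▸ h.mono hm.le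
      have e2 : s (j + (e + 1)) ≤ 0 := h0 ▸ h.mono (by omega)
      rw [max_eq_left ((min_le_right _ _).trans e1), max_eq_left ((min_le_right _ _).trans e2)]
      linarith
    · rcases lt_or_ge (j + e) (n + 1 + l * d) with hm' | hm'
      · have hle : max 0 (min 1 (s (j + (e + 1)))) - max 0 (min 1 (s (j + e))) ≤
            s (j + (e + 1)) - s (j + e) := by
          have e1 : 0 ≤ s (j + e) := h0 ▸ h.mono hm
          have e2 : s (j + (e + 1)) ≤ 1 := h1 ▸ h.mono (by omega)
          have e3 : s (j + e) ≤ s (j + (e + 1)) := h.mono (by omega)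
          rw [min_eq_right e2, min_eq_right (e3.trans e2), max_eq_right e1,
            max_eq_right (e1.trans e3)]
        refine hle.trans ?_
        rcases h.inner_gap hd hm hm' with ⟨i', hi', e1⟩ | e1
        · rw [← add_assoc, e1, h.left i' hi', h.right i' hi']
          exact hδ i' hi'
        · rw [← add_assoc, ← e1]; linarith
      · have e1 : 1 ≤ s (j + e) := h1 ▸ h.mono hm'
        have e2 : 1 ≤ s (j + (e + 1)) := h1 ▸ h.mono (by omega)
        rw [min_eq_left e1, min_eq_left e2]
        linarith
  have hsum := Finset.sum_le_sum hgap
  rw [Finset.sum_range_sub (fun e => c (j + e)), Finset.sum_const, Finset.card_range,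
    nsmul_eq_mul, add_zero] at hsum
  have key : ∀ z, z ∈ Icc (s j) (s (j + (n + 1))) → z ∈ Icc (0 : ℝ) 1 →
      c j ≤ z ∧ z ≤ c (j + (n + 1)) := fun z hz hz' =>
    ⟨max_le hz'.1 ((min_le_right _ _).trans hz.1), (le_min hz'.2 hz.2).trans (le_max_right _ _)⟩
  have kx := key x hx hx'
  have ky := key y hy hy'
  rw [abs_le]
  constructor <;> linarith

theorem IsAugmentedKnots.exists_mem_Ico {r l : ℕ} {t : ℤ → ℝ} (ht : IsAugmentedKnots r l t)
    {x : ℝ} (hx : x ∈ Ico (0 : ℝ) 1) : ∃ i : ℕ, i ≤ l ∧ x ∈ Ico (t i) (t (i + 1)) := by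
  have key : ∀ m : ℕ, x < t (m + 1) → ∃ i : ℕ, i ≤ m ∧ x ∈ Ico (t i) (t (i + 1)) := by
    intro m
    induction m with
    | zero =>
      intro hm
      exact ⟨0, le_rfl, by simpa [ht.zero] using hx.1, hm⟩
    | succ m ih =>
      intro hm
      by_cases h : x < t (m + 1)
      · obtain ⟨i, hi, h'⟩ := ih h
        exact ⟨i, by omega, h'⟩
      · refine ⟨m + 1, le_rfl, ?_, hm⟩
        push_cast
        exact not_lt.1 h
  exact key l (by rw [ht.one]; exact hx.2)

theorem ae_leb01_mem_Ioo {r l : ℕ} {t : ℤ → ℝ} (ht : IsAugmentedKnots r l t) :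
    ∀ᵐ x ∂leb01, ∃ i : ℕ, i ≤ l ∧ x ∈ Ioo (t i) (t (i + 1)) := by
  rw [leb01, ae_restrict_iff' measurableSet_Icc]
  have h1 : ∀ᵐ x : ℝ ∂volume, x ≠ 1 := by simp [ae_iff, measure_singleton]
  have h2 : ∀ᵐ x : ℝ ∂volume, ∀ i : ℤ, x ≠ t i := by
    rw [ae_all_iff]
    intro i
    simp [ae_iff, measure_singleton]
  filter_upwards [h1, h2] with x hx1 hx2 hx
  obtain ⟨i, hi, h⟩ := ht.exists_mem_Ico ⟨hx.1, lt_of_le_of_ne hx.2 hx1⟩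
  exact ⟨i, hi, lt_of_le_of_ne h.1 (hx2 i).symm, h.2⟩

theorem IsAugmentedKnots.Ioo_subset {r l : ℕ} {t : ℤ → ℝ} (hr : 1 ≤ r)
    (ht : IsAugmentedKnots r l t)
    {i : ℕ} (hi : i ≤ l) : Ioo (t i) (t (i + 1)) ⊆ Icc (0 : ℝ) 1 := by
  have h0 := ht.mono (i := 0) (j := i) (by omega) (by omega) (by omega)
  have h1 := ht.mono (i := i + 1) (j := l + 1) (by omega) (by omega) (by omega)
  rw [ht.zero] at h0
  rw [ht.one] at h1
  exact fun x hx => ⟨h0.trans hx.1.le, hx.2.le.trans h1⟩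

/-! ### The Schoenberg space -/

theorem KnotLayout.splineSum_eq (h : KnotLayout n d l t s) (a : ℕ → ℝ) {i : ℕ} (hi : i ≤ l)
    {x : ℝ} (hx : x ∈ Ico (t i) (t (i + 1))) :
    ∑ j ∈ Finset.range (n + 1 + l * d), a j * splineBasis (n + 1) d l t j x =
      (∑ j ∈ Finset.range (n + 1 + l * d),
        Polynomial.C (a j) * bsplinePoly s (n + i * d) (n + 1) j).eval x := by
  rw [h.Ico_eq hi] at hx
  rw [Polynomial.eval_finsetSum]
  refine Finset.sum_congr rfl fun j hj => ?_
  rw [h.splineBasis_eq (Finset.mem_range.1 hj), bspline_eq_eval h.mono hx, Polynomial.eval_mul,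
    Polynomial.eval_C]

theorem KnotLayout.splineSum_mem (h : KnotLayout n d l t s) (a : ℕ → ℝ) :
    (fun x => ∑ j ∈ Finset.range (n + 1 + l * d), a j * splineBasis (n + 1) d l t j x) ∈
      schoenbergSpace (n + 1) d l t := by
  constructor
  · intro i hi hi'
    lift i to ℕ using hi
    have hil : i ≤ l := by omega
    refine ⟨_, ?_, fun x hx => h.splineSum_eq a hil (Ioo_subset_Ico_self hx)⟩
    rw [← Polynomial.mem_degreeLT]
    refine Submodule.sum_mem _ fun j _ => ?_
    rw [← Polynomial.smul_eq_C_mul]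
    exact Submodule.smul_mem _ _ (Polynomial.mem_degreeLT.2 (bsplinePoly_degree_lt _ _ _ _))
  · intro hd i hi hi'
    obtain ⟨i, rfl⟩ : ∃ i' : ℕ, i = i' + 1 := ⟨(i - 1).toNat, by omega⟩
    have hil : i + 1 ≤ l := by omega
    have hb := h.lt (i + 1) hil
    push_cast at hb
    refine contDiffAt_piecewise_polynomial (h.lt i (by omega)) hb
      (fun x hx => h.splineSum_eq a (by omega) (Ioo_subset_Ico_self hx))
      (q := ∑ j ∈ Finset.range (n + 1 + l * d),
        Polynomial.C (a j) * bsplinePoly s (n + (i + 1) * d) (n + 1) j)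
      (fun x hx => h.splineSum_eq a hil (by push_cast; exact hx)) ?_
    rw [← Finset.sum_sub_distrib]
    refine Finset.dvd_sum fun j _ => ?_
    rw [← mul_sub]
    refine Dvd.dvd.mul_left ?_ _
    have h1 := h.gap_pos hil
    have e : n + (i + 1) * d = n + i * d + d := by ring
    rw [e] at h1 ⊢
    have := X_sub_C_pow_dvd_bsplinePoly_sub h.mono (μ := n + i * d) (n := n) (d := d) (by omega)
      (by omega) (h.gap_pos (by omega)) (h.mult i (by omega)) h1 j
    rwa [show n + 1 - 1 - d + 1 = n + 1 - d by omega]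

theorem exists_pieces_of_mem_schoenbergSpace (hl : ∀ i : ℕ, i ≤ l → t i < t (i + 1))
    {f : ℝ → ℝ} (hf : f ∈ schoenbergSpace (n + 1) d l t) :
    ∃ p : ℕ → Polynomial ℝ, (∀ i ≤ l, (p i).natDegree ≤ n) ∧
      (∀ i : ℕ, i ≤ l → ∀ x ∈ Ioo (t i) (t (i + 1)), f x = (p i).eval x) ∧
      ∀ i < l, (Polynomial.X - Polynomial.C (t (i + 1))) ^ (n + 1 - d) ∣ p i - p (i + 1) := by
  obtain ⟨hf1, hf2⟩ := hf
  have : ∀ i : ℕ, ∃ p : Polynomial ℝ, i ≤ l → p.degree < (n + 1 : ℕ) ∧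
      ∀ x ∈ Ioo (t i) (t (i + 1)), f x = p.eval x := by
    intro i
    by_cases hi : i ≤ l
    · obtain ⟨p, hp⟩ := hf1 i (by omega) (by omega)
      exact ⟨p, fun _ => hp⟩
    · exact ⟨0, fun h => absurd h hi⟩
  choose p hp using this
  refine ⟨p, fun i hi => ?_, fun i hi => (hp i hi).2, fun i hi => ?_⟩
  · exact natDegree_le_iff_mem_degreeLT.2 (Polynomial.mem_degreeLT.2 (hp i hi).1)
  · by_cases hd : d < n + 1
    · have hb := hl (i + 1) hi
      have h2 := (hp (i + 1) hi).2
      push_cast at hb h2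
      have := X_sub_C_pow_dvd_of_contDiffAt (hl i hi.le) hb (hf2 hd (i + 1) (by omega) (by omega))
        (hp i hi.le).2 h2
      rwa [show n + 1 - 1 - d + 1 = n + 1 - d by omega] at this
    -- Without smoothness conditions the exponent is zero and the divisibility is empty.
    · rw [show n + 1 - d = 0 by omega, pow_zero]
      exact one_dvd _

/-- Pass from i to i' one knot at a time; at each crossing `dualFunctional_eq_of_dvd` applies with
the base point at that knot. -/
theorem KnotLayout.dualFunctional_congr (h : KnotLayout n d l t s) {p : ℕ → Polynomial ℝ}
    (hp : ∀ i ≤ l, (p i).natDegree ≤ n)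
    (hp' : ∀ i < l, (Polynomial.X - Polynomial.C (t (i + 1))) ^ (n + 1 - d) ∣ p i - p (i + 1))
    {i i' j : ℕ} (hi : i ≤ l) (hi' : i' ≤ l) (h1 : i * d ≤ j) (h2 : j ≤ i * d + n)
    (h1' : i' * d ≤ j) (h2' : j ≤ i' * d + n) :
    dualFunctional s n j (p i) = dualFunctional s n j (p i') := by
  wlog hle : i ≤ i' generalizing i i'
  · exact (this hi' hi h1' h2' h1 h2 (by omega)).symm
  induction i', hle using Nat.le_induction with
  | base => rfl
  | succ m hm ih =>
    have e : (m + 1) * d = m * d + d := by ring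
    have hmd : i * d ≤ m * d := Nat.mul_le_mul_right d hm
    rw [ih (by omega) (by omega) (by omega)]
    exact dualFunctional_eq_of_dvd (h.mult m hi') (by omega) (by omega) (hp m (by omega))
      (hp (m + 1) hi') (hp' m hi')

theorem KnotLayout.splineSum_dualFunctional_eq (h : KnotLayout n d l t s)
    {f : ℝ → ℝ} {p : ℕ → Polynomial ℝ}
    (hp : ∀ i ≤ l, (p i).natDegree ≤ n)
    (hfp : ∀ i : ℕ, i ≤ l → ∀ x ∈ Ioo (t i) (t (i + 1)), f x = (p i).eval x)
    (hp' : ∀ i < l, (Polynomial.X - Polynomial.C (t (i + 1))) ^ (n + 1 - d) ∣ p i - p (i + 1))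
    {a : ℕ → ℝ}
    (ha : ∀ j < n + 1 + l * d, ∃ i ≤ l, i * d ≤ j ∧ j ≤ i * d + n ∧
      a j = dualFunctional s n j (p i)) {i : ℕ} (hi : i ≤ l) {x : ℝ}
    (hx : x ∈ Ioo (t i) (t (i + 1))) :
    ∑ j ∈ Finset.range (n + 1 + l * d), a j * splineBasis (n + 1) d l t j x = f x := by
  have hil : i * d ≤ l * d := Nat.mul_le_mul_right d hi
  rw [h.splineSum_eq a hi (Ioo_subset_Ico_self hx), hfp i hi x hx]
  congr 1
  conv_rhs => rw [← sum_dualFunctional_mul_bsplinePoly h.mono (h.gap_pos hi)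
    (show n + i * d < n + 1 + l * d by omega) (by omega) (hp i hi)]
  refine Finset.sum_congr rfl fun j hj => ?_
  by_cases hz : n + i * d < j ∨ j + (n + 1) ≤ n + i * d
  · rw [bsplinePoly_eq_zero _ _ _ _ hz, mul_zero, mul_zero]
  · obtain ⟨i', hi', h1, h2, e⟩ := ha j (Finset.mem_range.1 hj)
    rw [e, h.dualFunctional_congr hp hp' hi' hi h1 h2 (by omega) (by omega)]

end KnotLayout

/-! ### Existence of quasi-interpolants -/

open Polynomial in
theorem eq_zero_of_integral_sq_eq_zero {p : ℝ[X]}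
    (h : ∫ x in (0 : ℝ)..1, p.eval x * p.eval x = 0) : p = 0 := by
  by_contra hp
  have hpos : 0 < ∫ x in (0 : ℝ)..1, p.eval x * p.eval x := by
    obtain ⟨c, hc, hc0⟩ : ∃ c ∈ Icc (0 : ℝ) 1, p.eval c ≠ 0 := by
      by_contra! hall
      exact hp (Polynomial.eq_zero_of_infinite_isRoot p
        ((Icc_infinite (zero_lt_one' ℝ)).mono fun x hx => hall x hx))
    refine intervalIntegral.integral_pos zero_lt_one (by fun_prop)
      (fun x _ => mul_self_nonneg _) ⟨c, hc, ?_⟩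
    exact mul_self_pos.2 hc0
  exact hpos.ne' h

open Polynomial in
-- Riesz representation for the L₂ inner product on polynomials of degree at most n: definiteness
-- gives injectivity into the dual, equality of dimensions gives surjectivity.
theorem exists_representing_polynomial (n : ℕ) (L : ℝ[X] →ₗ[ℝ] ℝ) :
    ∃ φ : ℝ[X], ∀ p : ℝ[X], p.natDegree ≤ n →
      ∫ x in (0 : ℝ)..1, p.eval x * φ.eval x = L p := by
  have hint : ∀ p q : ℝ[X], IntervalIntegrable (fun x => p.eval x * q.eval x) volume 0 1 :=
    fun p q => Continuous.intervalIntegrable (by fun_prop) _ _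
  let Φ : degreeLT ℝ (n + 1) →ₗ[ℝ] Module.Dual ℝ (degreeLT ℝ (n + 1)) :=
    LinearMap.mk₂ ℝ (fun φ p => ∫ x in (0 : ℝ)..1, (p : ℝ[X]).eval x * (φ : ℝ[X]).eval x)
      (fun a b c => by
        simp only [Submodule.coe_add, eval_add, mul_add]
        exact intervalIntegral.integral_add (hint _ _) (hint _ _))
      (fun c a b => by
        simp only [Submodule.coe_smul, eval_smul, smul_eq_mul, mul_left_comm _ c]
        exact intervalIntegral.integral_const_mul _ _)
      (fun a b c => by
        simp only [Submodule.coe_add, eval_add, add_mul]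
        exact intervalIntegral.integral_add (hint _ _) (hint _ _))
      (fun c a b => by
        simp only [Submodule.coe_smul, eval_smul, smul_eq_mul, mul_assoc]
        exact intervalIntegral.integral_const_mul _ _)
  have hinj : Function.Injective Φ := by
    rw [← LinearMap.ker_eq_bot, LinearMap.ker_eq_bot']
    intro φ hφ
    have h1 : Φ φ φ = 0 := by rw [hφ]; rfl
    exact Subtype.ext (eq_zero_of_integral_sq_eq_zero h1)
  have : FiniteDimensional ℝ (degreeLT ℝ (n + 1)) :=
    (degreeLTEquiv ℝ (n + 1)).symm.finiteDimensional
  have hsurj : Function.Surjective Φ := by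
    rw [← LinearMap.injective_iff_surjective_of_finrank_eq_finrank]
    · exact hinj
    · exact (Subspace.dual_finrank_eq).symm
  obtain ⟨φ, hφ⟩ := hsurj (L.comp (degreeLT ℝ (n + 1)).subtype)
  refine ⟨φ, fun p hp => ?_⟩
  have := LinearMap.congr_fun hφ ⟨p, natDegree_le_iff_mem_degreeLT.1 hp⟩
  exact this

open Polynomial in
theorem abs_coeff_prod_X_sub_C_le {R : ℝ} (hR : 0 ≤ R) (N : ℕ) (v : ℕ → ℝ)
    (hv : ∀ i < N, |v i| ≤ R) (k : ℕ) (hk : k ≤ N) :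
    |(∏ i ∈ Finset.range N, (X - C (v i))).coeff k| ≤ 2 ^ N * R ^ (N - k) := by
  induction N generalizing k with
  | zero =>
    obtain rfl : k = 0 := by omega
    simp
  | succ N ih =>
    set P := ∏ i ∈ Finset.range N, (X - C (v i)) with hP
    have ih' := ih fun i hi => hv i (by omega)
    have hdeg : P.natDegree = N := by
      rw [hP, natDegree_prod_of_monic _ _ fun i _ => monic_X_sub_C _]; simp
    rw [Finset.prod_range_succ, mul_sub, coeff_sub, coeff_mul_C]
    have hb : |P.coeff k * v N| ≤ 2 ^ N * R ^ (N + 1 - k) := by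
      rcases hk.lt_or_eq with hk | rfl
      · rw [abs_mul, show N + 1 - k = N - k + 1 by omega, pow_succ, ← mul_assoc]
        exact mul_le_mul (ih' k (by omega)) (hv N (by omega)) (abs_nonneg _) (by positivity)
      · rw [coeff_eq_zero_of_natDegree_lt (by omega)]
        simp
    have ha : |(P * X).coeff k| ≤ 2 ^ N * R ^ (N + 1 - k) := by
      cases k with
      | zero => simp; positivity
      | succ k =>
        rw [coeff_mul_X, show N + 1 - (k + 1) = N - k by omega]
        exact ih' k (by omega)
    calc _ ≤ |(P * X).coeff k| + |P.coeff k * v N| := abs_sub _ _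
      _ ≤ _ := by rw [pow_succ]; linarith

open Polynomial in
theorem eval_iterate_derivative_eq_coeff_taylor (p : ℝ[X]) (a : ℝ) (m : ℕ) :
    (derivative^[m] p).eval a = m.factorial * (taylor a p).coeff m := by
  rw [taylor_coeff, ← factorial_smul_hasseDeriv]
  simp

open Polynomial in
-- After translation by a the derivative is a factorial times a coefficient, homogeneous of degree m
-- in the shifted roots. The power R^m later cancels the h^{-m} from differentiating p.
theorem abs_eval_iterate_derivative_dualPoly_le {s : ℕ → ℝ} {n j : ℕ} {a R : ℝ} (hR : 0 ≤ R)
    (hs : ∀ i < n, |s (j + 1 + i) - a| ≤ R) {m : ℕ} (hm : m ≤ n) :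
    |(derivative^[n - m] (dualPoly s n j)).eval a| ≤ n.factorial * (2 ^ n * R ^ m) := by
  rw [eval_iterate_derivative_eq_coeff_taylor, abs_mul, Nat.abs_cast]
  have e : taylor a (dualPoly s n j) =
      ∏ i ∈ Finset.range n, (X - C (s (j + 1 + i) - a)) := by
    rw [dualPoly, taylor_apply, prod_comp]
    refine Finset.prod_congr rfl fun i _ => ?_
    simp only [sub_comp, X_comp, C_comp, C_sub]
    ring
  have h2 := abs_coeff_prod_X_sub_C_le hR n (fun i => s (j + 1 + i) - a) hs (n - m) (by omega)
  rw [show n - (n - m) = m by omega] at h2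
  rw [e]
  exact mul_le_mul (by exact_mod_cast Nat.factorial_le (Nat.sub_le n m)) h2 (abs_nonneg _)
    (by positivity)

open Polynomial in
/-- The de Boor–Fix functional is represented on an interval `(a, a + h)` by a function that is
bounded by a multiple of `h⁻¹`, as long as the knots are at distance `O(h)` from `a`. -/
theorem exists_dual_density (n : ℕ) : ∃ D : ℝ, 0 ≤ D ∧
    ∀ (s : ℕ → ℝ) (j : ℕ) (a h : ℝ), 0 < h →
      (∀ i < n, |s (j + 1 + i) - a| ≤ ((n + 1 : ℕ) : ℝ) * h) →
      ∃ c : ℝ → ℝ, Measurable c ∧ (∀ x, |c x| ≤ D / h) ∧ (∀ x ∉ Ioo a (a + h), c x = 0) ∧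
        ∀ p : ℝ[X], p.natDegree ≤ n →
          ∫ x in Ioo a (a + h), p.eval x * c x = dualFunctional s n j p := by
  -- `φ m` represents the m-th coefficient on [0,1]; it does not depend on the knots, which makes
  -- `D` universal.
  choose φ hφ using fun m : ℕ => exists_representing_polynomial n (lcoeff ℝ m)
  have hA : ∀ m, ∃ A, ∀ x ∈ Icc (0 : ℝ) 1, |(φ m).eval x| ≤ A := fun m =>
    isCompact_Icc.exists_bound_of_continuousOn (φ m).continuous.continuousOn
  choose A hA using hA
  have hA0 : ∀ m, 0 ≤ A m := fun m => (abs_nonneg _).trans (hA m 0 (by simp))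
  set V : ℕ → ℝ := fun m => m.factorial * (2 ^ n * ((n + 1 : ℕ) : ℝ) ^ m) with hV
  refine ⟨∑ m ∈ Finset.range (n + 1), V m * A m,
    Finset.sum_nonneg fun m _ => mul_nonneg (by positivity) (hA0 m), ?_⟩
  intro s j a h hh hs
  -- The weights of the functional, with base point a, in terms of the coefficients of p(a + hX).
  set w : ℕ → ℝ := fun m => (-1) ^ m * (m.factorial * (h ^ m)⁻¹ *
    ((derivative^[n - m] (dualPoly s n j)).eval a / n.factorial)) with hw
  have hwV : ∀ m ≤ n, |w m| ≤ V m := by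
    intro m hm
    have := abs_eval_iterate_derivative_dualPoly_le (by positivity) hs hm
    simp only [hw, hV]
    rw [abs_mul, abs_pow, abs_neg, abs_one, one_pow, one_mul, abs_mul, abs_mul, Nat.abs_cast,
      abs_inv, abs_pow, abs_of_pos hh, abs_div, Nat.abs_cast, mul_assoc]
    refine mul_le_mul_of_nonneg_left ?_ (by positivity)
    rw [inv_mul_le_iff₀ (by positivity), div_le_iff₀ (by positivity)]
    refine this.trans (le_of_eq ?_)
    rw [mul_pow]
    ring
  set q : ℝ[X] := ∑ m ∈ Finset.range (n + 1), C (w m) * φ m with hq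
  have hqb : ∀ x ∈ Icc (0 : ℝ) 1, |q.eval x| ≤ ∑ m ∈ Finset.range (n + 1), V m * A m := by
    intro x hx
    rw [hq, eval_finsetSum]
    refine (Finset.abs_sum_le_sum_abs _ _).trans (Finset.sum_le_sum fun m hm => ?_)
    rw [eval_mul, eval_C, abs_mul]
    exact mul_le_mul (hwV m (by rw [Finset.mem_range] at hm; omega)) (hA m x hx) (abs_nonneg _)
      (by positivity)
  refine ⟨(Ioo a (a + h)).indicator fun x => h⁻¹ * q.eval ((x - a) / h), ?_, ?_, ?_, ?_⟩
  · refine Measurable.indicator ?_ measurableSet_Ioo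
    exact Continuous.measurable (by fun_prop)
  · intro x
    by_cases hx : x ∈ Ioo a (a + h)
    · rw [indicator_of_mem hx, abs_mul, abs_inv, abs_of_pos hh, inv_mul_eq_div]
      refine div_le_div_of_nonneg_right (hqb _ ⟨?_, ?_⟩) hh.le
      · exact div_nonneg (by linarith [hx.1]) hh.le
      · rw [div_le_one hh]; linarith [hx.2]
    · rw [indicator_of_notMem hx, abs_zero]
      exact div_nonneg (Finset.sum_nonneg fun m _ => mul_nonneg (by positivity) (hA0 m)) hh.le
  · intro x hx
    exact indicator_of_notMem hx _
  · intro p hp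
    set pt : ℝ[X] := (taylor a p).comp (C h * X) with hpt
    have hpte : ∀ u, pt.eval u = p.eval (a + h * u) := by
      intro u
      simp [hpt, taylor_eval, add_comm]
    have hptd : pt.natDegree ≤ n := by
      refine natDegree_comp_le.trans ?_
      rw [natDegree_taylor]
      calc p.natDegree * (C h * X).natDegree ≤ n * 1 :=
            Nat.mul_le_mul hp ((natDegree_C_mul_le _ _).trans natDegree_X_le)
        _ = n := mul_one n
    have h1 : ∫ x in Ioo a (a + h), p.eval x *
        (Ioo a (a + h)).indicator (fun x => h⁻¹ * q.eval ((x - a) / h)) x =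
        ∫ x in a..(a + h), h⁻¹ * (p.eval x * q.eval ((x - a) / h)) := by
      rw [intervalIntegral.integral_of_le (by linarith), integral_Ioc_eq_integral_Ioo]
      refine setIntegral_congr_fun measurableSet_Ioo fun x hx => ?_
      simp only [indicator_of_mem hx]
      ring
    have h2 : ∫ x in a..(a + h), h⁻¹ * (p.eval x * q.eval ((x - a) / h)) =
        ∫ u in (0 : ℝ)..1, pt.eval u * q.eval u := by
      have := intervalIntegral.integral_comp_add_mul (a := 0) (b := 1)
        (fun x => p.eval x * q.eval ((x - a) / h)) hh.ne' a
      rw [intervalIntegral.integral_const_mul]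
      simp only [mul_zero, add_zero, mul_one, smul_eq_mul] at this
      rw [← this]
      refine intervalIntegral.integral_congr fun u _ => ?_
      simp only [hpte, add_sub_cancel_left]
      rw [mul_div_cancel_left₀ _ hh.ne']
    have h3 : ∫ u in (0 : ℝ)..1, pt.eval u * q.eval u =
        ∑ m ∈ Finset.range (n + 1), w m * pt.coeff m := by
      simp only [hq, eval_finsetSum, eval_mul, eval_C, Finset.mul_sum]
      rw [intervalIntegral.integral_finsetSum
        fun m _ => Continuous.intervalIntegrable (by fun_prop) _ _]
      refine Finset.sum_congr rfl fun m _ => ?_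
      simp only [mul_left_comm _ (w m)]
      rw [intervalIntegral.integral_const_mul, hφ m pt hptd]
      rfl
    rw [h1, h2, h3, dualFunctional_eq s j hp a, concomitant, eval_finsetSum, Finset.sum_div]
    refine Finset.sum_congr rfl fun m _ => ?_
    rw [eval_smul, eval_mul, eval_iterate_derivative_eq_coeff_taylor p, hpt, comp_C_mul_X_coeff]
    simp only [hw, smul_eq_mul]
    have hh' : h ^ m ≠ 0 := pow_ne_zero _ hh.ne'
    field_simp

instance : IsFiniteMeasure leb01 := by unfold leb01; infer_instance

/-- Hölder's inequality on [u, v]: the L₁ norm costs a factor (v - u)^{1-1/p}, and the bound on c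
contributes (v - u)^{-1}. -/
theorem abs_coeffFunctional_le {u v K : ℝ} (huv : u < v) (hK : 0 ≤ K) {c : ℝ → ℝ}
    (hc : ∀ x, |c x| ≤ (Icc u v).indicator (fun _ => K / (v - u)) x) {p : ℝ≥0∞}
    (hp : 1 ≤ p) {f : ℝ → ℝ} (hf : MemLp f p leb01) :
    |coeffFunctional c f| ≤ K * (v - u) ^ (-(p⁻¹).toReal) *
      (eLpNorm ((Icc u v).indicator f) p leb01).toReal := by
  have hlen : 0 < v - u := sub_pos.2 huv
  have hfi : Integrable f leb01 := memLp_one_iff_integrable.1 (hf.mono_exponent hp)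
  set F := (Icc u v).indicator f with hF
  have hFi : Integrable F leb01 := hfi.indicator measurableSet_Icc
  have hFp : MemLp F p leb01 := hf.indicator measurableSet_Icc
  have h1 : |coeffFunctional c f| ≤ ∫ x, K / (v - u) * |F x| ∂leb01 := by
    rw [coeffFunctional, ← Real.norm_eq_abs]
    refine norm_integral_le_of_norm_le (hFi.abs.const_mul _) (Eventually.of_forall fun x => ?_)
    rw [Real.norm_eq_abs, abs_mul, mul_comm]
    have := hc x
    by_cases hx : x ∈ Icc u v
    · rw [indicator_of_mem hx] at this
      rw [hF, indicator_of_mem hx]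
      exact mul_le_mul_of_nonneg_right this (abs_nonneg _)
    · rw [indicator_of_notMem hx] at this
      rw [hF, indicator_of_notMem hx, abs_zero, mul_zero]
      exact mul_nonpos_of_nonpos_of_nonneg this (abs_nonneg _)
  rw [integral_const_mul] at h1
  have h2 : ∫ x, |F x| ∂leb01 = (eLpNorm F 1 leb01).toReal := by
    rw [eLpNorm_one_eq_lintegral_enorm, ← integral_norm_eq_lintegral_enorm hFi.1]
    rfl
  -- Only an inequality, as the support may reach outside [0,1]; it suffices because 1 - 1/p ≥ 0.
  have hμ : leb01 (Icc u v) ≤ ENNReal.ofReal (v - u) := by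
    rw [← Real.volume_Icc]
    exact Measure.restrict_apply_le _ _
  have hexp : 0 ≤ 1 - (p⁻¹).toReal := by
    rw [sub_nonneg]
    refine ENNReal.toReal_le_of_le_ofReal zero_le_one ?_
    rw [ENNReal.ofReal_one]
    exact ENNReal.inv_le_one.2 hp
  have h3 : eLpNorm F 1 leb01 ≤
      eLpNorm F p leb01 * ENNReal.ofReal ((v - u) ^ (1 - (p⁻¹).toReal)) := by
    simp only [hF, eLpNorm_indicator_eq_eLpNorm_restrict measurableSet_Icc]
    refine (eLpNorm_le_eLpNorm_mul_rpow_measure_univ hp hf.1.restrict).trans ?_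
    gcongr
    rw [← ENNReal.ofReal_rpow_of_pos hlen, Measure.restrict_apply_univ]
    have e : 1 / (1 : ℝ≥0∞).toReal - 1 / p.toReal = 1 - (p⁻¹).toReal := by
      rw [ENNReal.toReal_inv]; simp
    rw [e]
    exact ENNReal.rpow_le_rpow hμ hexp
  have h4 : (eLpNorm F 1 leb01).toReal ≤
      (eLpNorm F p leb01).toReal * (v - u) ^ (1 - (p⁻¹).toReal) := by
    refine (ENNReal.toReal_mono (ENNReal.mul_ne_top hFp.2.ne ENNReal.ofReal_ne_top) h3).trans ?_
    rw [ENNReal.toReal_mul, ENNReal.toReal_ofReal (by positivity)]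
  calc |coeffFunctional c f| ≤ K / (v - u) * (eLpNorm F 1 leb01).toReal := h2 ▸ h1
    _ ≤ K / (v - u) * ((eLpNorm F p leb01).toReal * (v - u) ^ (1 - (p⁻¹).toReal)) := by gcongr
    _ = _ := by
      rw [sub_eq_add_neg 1, Real.rpow_add hlen, Real.rpow_one]
      field_simp

theorem exists_isQuasiInterpolant (r : ℕ) (hr : 1 ≤ r) :
    ∃ C : ℝ, ∀ (d l : ℕ) (t : ℤ → ℝ), 1 ≤ d → d ≤ r →
      IsAugmentedKnots r l t → OuterKnotsControlled r l t →
      ∃ c : ℕ → ℝ → ℝ, IsQuasiInterpolant r d l t C c := by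
  obtain ⟨n, rfl⟩ : ∃ n, r = n + 1 := ⟨r - 1, by omega⟩
  obtain ⟨D, hD0, hD⟩ := exists_dual_density n
  -- `D` bounds the density relative to the long interval, and n + 1 converts its length into that
  -- of the support.
  refine ⟨D * ((n + 1 : ℕ) : ℝ), ?_⟩
  intro d l t hd hdn ht ho
  obtain ⟨s, h⟩ := ht.exists_layout hd
  have hex : ∀ j, ∃ (i : ℕ) (c : ℝ → ℝ), j < n + 1 + l * d →
      (i ≤ l ∧ i * d ≤ j ∧ j ≤ i * d + n) ∧ Measurable c ∧
      (∀ x, |c x| ≤ (Icc (s j) (s (j + (n + 1)))).indicator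
        (fun _ => D * ((n + 1 : ℕ) : ℝ) / (s (j + (n + 1)) - s j)) x) ∧
      (∀ x ∉ Ioo (t i) (t (i + 1)), c x = 0) ∧
      ∀ p : Polynomial ℝ, p.natDegree ≤ n →
          ∫ x in Ioo (t i) (t (i + 1)), p.eval x * c x = dualFunctional s n j p := by
    intro j
    by_cases hj : j < n + 1 + l * d
    swap
    · exact ⟨0, 0, fun h => absurd h hj⟩
    obtain ⟨i, hi, h1, h2, hlen⟩ := h.exists_long_gap hd hdn ho hj
    have hgap : 0 < t (i + 1) - t i := sub_pos.2 (h.lt i hi)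
    have hlen0 := hgap.trans_le (h.gap_le_length hi h1 h2)
    have hl1 : s j ≤ t i := by rw [← h.left i hi]; exact h.mono (by omega)
    have hl2 : t (i + 1) ≤ s (j + (n + 1)) := by rw [← h.right i hi]; exact h.mono (by omega)
    obtain ⟨c, hcm, hcb, hc0, hc⟩ := hD s j (t i) (t (i + 1) - t i) hgap (by
      intro i' hi'
      refine le_trans ?_ hlen
      have e1 := h.mono (show j ≤ j + 1 + i' by omega)
      have e2 := h.mono (show j + 1 + i' ≤ j + (n + 1) by omega)
      rw [abs_le]
      constructor <;> linarith)
    rw [add_sub_cancel] at hc0 hc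
    refine ⟨i, c, fun _ => ⟨⟨hi, h1, h2⟩, hcm, fun x => ?_, hc0, hc⟩⟩
    by_cases hx : x ∈ Icc (s j) (s (j + (n + 1)))
    · rw [indicator_of_mem hx]
      refine (hcb x).trans ?_
      rw [div_le_div_iff₀ hgap hlen0, mul_assoc]
      exact mul_le_mul_of_nonneg_left hlen hD0
    · rw [indicator_of_notMem hx, hc0 x fun hx' =>
        hx ⟨hl1.trans hx'.1.le, hx'.2.le.trans hl2⟩, abs_zero]
  choose ι c hc using hex
  have hlen : ∀ j < n + 1 + l * d, s j < s (j + (n + 1)) := fun j hj => by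
    obtain ⟨hi, h1, h2⟩ := (hc j hj).1
    have := h.gap_le_length hi h1 h2
    linarith [h.lt _ hi]
  refine ⟨c, fun j hj => (hc j hj).2.1, fun j hj => ?_, fun f _ => ?_, fun f hf => ?_,
    fun j hj p hp f hf => ?_⟩
  · refine memLp_top_of_bound (hc j hj).2.1.aestronglyMeasurable
      (D * ((n + 1 : ℕ) : ℝ) / (s (j + (n + 1)) - s j)) (Eventually.of_forall fun x => ?_)
    refine ((hc j hj).2.2.1 x).trans (indicator_le_self' (fun _ _ => ?_) x)
    have := hlen j hj
    exact div_nonneg (by positivity) (by linarith)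
  · exact h.splineSum_mem _
  · obtain ⟨p, hp, hfp, hp'⟩ := exists_pieces_of_mem_schoenbergSpace h.lt hf
    filter_upwards [ae_leb01_mem_Ioo ht] with x ⟨i, hi, hx⟩
    refine h.splineSum_dualFunctional_eq hp hfp hp' (fun j hj => ?_) hi hx
    obtain ⟨⟨hi, h1, h2⟩, -, -, hc0, hcp⟩ := hc j hj
    refine ⟨ι j, hi, h1, h2, ?_⟩
    rw [← hcp _ (hp _ hi), coeffFunctional, leb01]
    rw [setIntegral_eq_of_subset_of_forall_sdiff_eq_zero measurableSet_Icc
      (ht.Ioo_subset (by omega) hi) fun x hx => by rw [hc0 x hx.2, mul_zero]]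
    refine setIntegral_congr_fun measurableSet_Ioo fun x hx => ?_
    simp only [hfp _ hi x hx]
  · rw [← h.agree j (by omega), ← h.agree (j + (n + 1)) (by omega)]
    exact abs_coeffFunctional_le (hlen j hj) (by positivity) (hc j hj).2.2.1 hp hf

/-! ### The kernel of a quasi-interpolant -/

section Kernel

variable {n d l : ℕ} {t : ℤ → ℝ} {s : ℕ → ℝ} {C : ℝ} {c : ℕ → ℝ → ℝ}

theorem KnotLayout.length_pos (h : KnotLayout n d l t s) (hdn : d ≤ n + 1) {j : ℕ}
    (hj : j < n + 1 + l * d) : s j < s (j + (n + 1)) := by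
  obtain ⟨i, hi, h1, h2⟩ := exists_interval_index hdn hj
  have := h.gap_le_length hi h1 h2
  linarith [h.lt i hi]

/-- Duality of L₁ and L_∞: test the bound for p = 1 with the sign of c_j on an arbitrary measurable
set. The absolute value of C appears because its sign is not given. -/
theorem KnotLayout.ae_abs_coeff_le (h : KnotLayout n d l t s) (hdn : d ≤ n + 1)
    (hc : IsQuasiInterpolant (n + 1) d l t C c) {j : ℕ} (hj : j < n + 1 + l * d) :
    ∀ᵐ x ∂leb01, |c j x| ≤
      (Icc (s j) (s (j + (n + 1)))).indicator (fun _ => |C| / (s (j + (n + 1)) - s j)) x := by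
  have hlen : 0 < s (j + (n + 1)) - s j := sub_pos.2 (h.length_pos hdn hj)
  have hci : Integrable (c j) leb01 :=
    memLp_one_iff_integrable.1 ((hc.memLp_top j hj).mono_exponent le_top)
  refine ae_le_of_forall_setIntegral_le hci.abs
    ((integrable_const _).indicator measurableSet_Icc) fun A hA _ => ?_
  set u := s j with hu
  set v := s (j + (n + 1)) with hv
  set g : ℝ → ℝ := fun x => if 0 ≤ c j x then 1 else -1 with hg
  set f : ℝ → ℝ := A.indicator g with hf
  have hfm : Measurable f := (Measurable.ite
    (measurableSet_le measurable_const (hc.measurable j hj)) measurable_const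
    measurable_const).indicator hA
  have hfb : ∀ x, |f x| ≤ A.indicator (fun _ => 1) x := by
    intro x
    by_cases hx : x ∈ A
    · simp only [hf, indicator_of_mem hx, hg]
      split_ifs <;> simp
    · simp [hf, indicator_of_notMem hx]
  have hfi : Integrable f leb01 := by
    refine Integrable.of_bound hfm.aestronglyMeasurable 1 (Eventually.of_forall fun x => ?_)
    exact (hfb x).trans (indicator_le_self' (fun _ _ => zero_le_one) x)
  have h1 : coeffFunctional (c j) f = ∫ x in A, |c j x| ∂leb01 := by
    rw [coeffFunctional, ← integral_indicator hA]
    congr 1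
    funext x
    by_cases hx : x ∈ A
    · simp only [hf, indicator_of_mem hx, hg]
      split_ifs with h0
      · rw [one_mul, abs_of_nonneg h0]
      · rw [neg_one_mul, abs_of_neg (not_le.1 h0)]
    · simp [hf, indicator_of_notMem hx]
  have h2 := hc.bound j hj 1 le_rfl f (memLp_one_iff_integrable.2 hfi)
  rw [← h.agree j (by omega), ← h.agree (j + (n + 1)) (by omega), h1, ← hu, ← hv] at h2
  have hFi : Integrable ((Icc u v).indicator f) leb01 := hfi.indicator measurableSet_Icc
  have h3 : (eLpNorm ((Icc u v).indicator f) 1 leb01).toReal ≤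
      ∫ x in A, (Icc u v).indicator (fun _ => (1 : ℝ)) x ∂leb01 := by
    rw [eLpNorm_one_eq_lintegral_enorm, ← integral_norm_eq_lintegral_enorm hFi.1,
      ← integral_indicator hA]
    refine integral_mono hFi.norm
      (((integrable_const _).indicator measurableSet_Icc).indicator hA) fun x => ?_
    have h0 := hfb x
    by_cases hx : x ∈ Icc u v <;> by_cases hx' : x ∈ A <;> simp_all
  have h4 : ∫ x in A, (Icc u v).indicator (fun _ => |C| / (v - u)) x ∂leb01 =
      |C| / (v - u) * ∫ x in A, (Icc u v).indicator (fun _ => (1 : ℝ)) x ∂leb01 := by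
    rw [← integral_const_mul]
    congr 1
    funext x
    rw [← Set.indicator_const_mul]
    simp
  rw [h4]
  refine (le_abs_self _).trans (h2.trans ?_)
  have h5 : (v - u) ^ (-((1 : ℝ≥0∞)⁻¹).toReal) = (v - u)⁻¹ := by
    simp [Real.rpow_neg_one]
  rw [h5, ← div_eq_mul_inv]
  refine mul_le_mul ?_ h3 ENNReal.toReal_nonneg (by positivity)
  exact div_le_div_of_nonneg_right (le_abs_self C) hlen.le

theorem KnotLayout.splineBasis_nonneg (h : KnotLayout n d l t s) {i j : ℕ} (hi : i ≤ l)
    (hj : j < n + 1 + l * d) {x : ℝ} (hx : x ∈ Ico (t i) (t (i + 1))) :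
    0 ≤ splineBasis (n + 1) d l t j x := by
  rw [h.splineBasis_eq hj]
  exact bspline_nonneg h.mono (h.Ico_eq hi ▸ hx) _ _

theorem KnotLayout.sum_splineBasis (h : KnotLayout n d l t s) {i : ℕ} (hi : i ≤ l)
    {x : ℝ} (hx : x ∈ Ico (t i) (t (i + 1))) :
    ∑ j ∈ Finset.range (n + 1 + l * d), splineBasis (n + 1) d l t j x = 1 := by
  have hil : i * d ≤ l * d := Nat.mul_le_mul_right d hi
  rw [← sum_bspline_eq_one (n := n) h.mono (show n + i * d < n + 1 + l * d by omega) (by omega)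
    (h.Ico_eq hi ▸ hx)]
  exact Finset.sum_congr rfl fun j hj => by rw [h.splineBasis_eq (Finset.mem_range.1 hj)]

theorem KnotLayout.mem_Icc_of_splineBasis_ne_zero (h : KnotLayout n d l t s) {i j : ℕ}
    (hi : i ≤ l) (hj : j < n + 1 + l * d) {x : ℝ} (hx : x ∈ Ico (t i) (t (i + 1)))
    (h0 : splineBasis (n + 1) d l t j x ≠ 0) : x ∈ Icc (s j) (s (j + (n + 1))) := by
  rw [h.Ico_eq hi] at hx
  rw [h.splineBasis_eq hj, bspline_eq_eval h.mono hx] at h0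
  by_cases hz : n + i * d < j ∨ j + (n + 1) ≤ n + i * d
  · rw [bsplinePoly_eq_zero _ _ _ _ hz, Polynomial.eval_zero] at h0
    exact absurd rfl h0
  · exact ⟨(h.mono (by omega)).trans hx.1, hx.2.le.trans (h.mono (by omega))⟩

theorem ae_leb01_mem : ∀ᵐ x ∂leb01, x ∈ Icc (0 : ℝ) 1 :=
  ae_restrict_mem measurableSet_Icc

/-- The kernel of a quasi-interpolant is concentrated near the diagonal. -/
theorem KnotLayout.exists_kernel_band (h : KnotLayout n d l t s) (hd : 1 ≤ d) (hdn : d ≤ n + 1)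
    (ht : IsAugmentedKnots (n + 1) l t) (hc : IsQuasiInterpolant (n + 1) d l t C c) {α δ : ℝ}
    (hα : 0 < α) (hαt : ∀ i : ℕ, i ≤ l → α ≤ t (i + 1) - t i)
    (hδt : ∀ i : ℕ, i ≤ l → t (i + 1) - t i ≤ δ) :
    ∃ S : Set ℝ, (∀ᵐ x ∂leb01, x ∈ S) ∧ ∀ x ∈ S, ∀ y ∈ S,
      |splineKernel (n + 1) d l t c x y| ≤ |C| / α ∧
      (((n + 1 : ℕ) : ℝ) * δ < |x - y| → splineKernel (n + 1) d l t c x y = 0) := by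
  -- The points where the partition of unity and all bounds on the finitely many c_j hold.
  refine ⟨{x | x ∈ Icc (0 : ℝ) 1 ∧ (∃ i : ℕ, i ≤ l ∧ x ∈ Ico (t i) (t (i + 1))) ∧
    ∀ j ∈ Finset.range (n + 1 + l * d), |c j x| ≤
      (Icc (s j) (s (j + (n + 1)))).indicator (fun _ => |C| / (s (j + (n + 1)) - s j)) x}, ?_, ?_⟩
  · have h1 : ∀ᵐ x ∂leb01, ∀ j ∈ Finset.range (n + 1 + l * d), |c j x| ≤
        (Icc (s j) (s (j + (n + 1)))).indicator
          (fun _ => |C| / (s (j + (n + 1)) - s j)) x := by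
      rw [Finset.eventually_all]
      exact fun j hj => h.ae_abs_coeff_le hdn hc (Finset.mem_range.1 hj)
    filter_upwards [h1, ae_leb01_mem, ae_leb01_mem_Ioo ht] with x hx1 hx2 ⟨i, hi, hx3⟩
    exact ⟨hx2, ⟨i, hi, Ioo_subset_Ico_self hx3⟩, hx1⟩
  · rintro x ⟨hx1, ⟨i, hi, hx⟩, -⟩ y ⟨hy1, -, hy⟩
    constructor
    -- The N_j(x) are nonnegative with sum one, so the kernel is an average of the c_j(y); each
    -- support has length at least α.
    · calc |splineKernel (n + 1) d l t c x y|
          ≤ ∑ j ∈ Finset.range (n + 1 + l * d), |splineBasis (n + 1) d l t j x * c j y| :=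
            Finset.abs_sum_le_sum_abs _ _
        _ ≤ ∑ j ∈ Finset.range (n + 1 + l * d), splineBasis (n + 1) d l t j x * (|C| / α) := by
            refine Finset.sum_le_sum fun j hj => ?_
            have hj' := Finset.mem_range.1 hj
            have h0 := h.splineBasis_nonneg hi hj' hx
            rw [abs_mul, abs_of_nonneg h0]
            refine mul_le_mul_of_nonneg_left ((hy j hj).trans ?_) h0
            have hlen := sub_pos.2 (h.length_pos hdn hj')
            refine (indicator_le_self' (fun _ _ => by positivity) y).trans ?_
            obtain ⟨i', hi', h1, h2⟩ := exists_interval_index hdn hj'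
            exact div_le_div_of_nonneg_left (abs_nonneg C) hα
              ((hαt i' hi').trans (h.gap_le_length hi' h1 h2))
        _ = |C| / α := by rw [← Finset.sum_mul, h.sum_splineBasis hi hx, one_mul]
    · intro hlt
      refine Finset.sum_eq_zero fun j hj => ?_
      have hj' := Finset.mem_range.1 hj
      by_cases h0 : splineBasis (n + 1) d l t j x = 0
      · rw [h0, zero_mul]
      · have hxj := h.mem_Icc_of_splineBasis_ne_zero hi hj' hx h0
        have hyj : y ∉ Icc (s j) (s (j + (n + 1))) := fun hyj =>
          absurd (h.abs_sub_le hd ht hδt hxj hx1 hyj hy1) (not_le.2 hlt)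
        have := hy j hj
        rw [indicator_of_notMem hyj] at this
        rw [abs_nonpos_iff.1 this, mul_zero]

theorem measurable_splineKernel (hc : ∀ j < n + 1 + l * d, Measurable (c j)) :
    Measurable (Function.uncurry (splineKernel (n + 1) d l t c)) := by
  unfold Function.uncurry splineKernel
  refine Finset.measurable_sum _ fun j hj => ?_
  exact ((measurable_bspline _ _ _).comp measurable_fst).mul
    ((hc j (Finset.mem_range.1 hj)).comp measurable_snd)

/-- The functionals of a quasi-interpolant are biorthogonal to the basis functions. -/
theorem KnotLayout.coeffFunctional_splineBasis (h : KnotLayout n d l t s) (hdn : d ≤ n + 1)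
    (ht : IsAugmentedKnots (n + 1) l t) (hc : IsQuasiInterpolant (n + 1) d l t C c) {k j : ℕ}
    (hk : k < n + 1 + l * d) (hj : j < n + 1 + l * d) :
    coeffFunctional (c k) (splineBasis (n + 1) d l t j) = if k = j then 1 else 0 := by
  set a : ℕ → ℝ := fun k => if k = j then 1 else 0 with ha
  set b : ℕ → ℝ := fun k => coeffFunctional (c k) (splineBasis (n + 1) d l t j) with hb
  have e : (fun x => ∑ k ∈ Finset.range (n + 1 + l * d), a k * splineBasis (n + 1) d l t k x) =
      splineBasis (n + 1) d l t j := by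
    funext x
    simp [ha, hj]
  have hmem := h.splineSum_mem a
  rw [e] at hmem
  have hproj := hc.proj _ hmem
  obtain ⟨i, hi, h1, h2⟩ := exists_interval_index hdn hk
  have hil : i * d ≤ l * d := Nat.mul_le_mul_right d hi
  have hzero : ∑ k ∈ Finset.range (n + 1 + l * d),
      Polynomial.C (b k - a k) * bsplinePoly s (n + i * d) (n + 1) k = 0 := by
    set P := ∑ k ∈ Finset.range (n + 1 + l * d),
      Polynomial.C (b k - a k) * bsplinePoly s (n + i * d) (n + 1) k with hP
    -- The polynomial vanishes almost everywhere on a nondegenerate interval, so its roots cannot be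
    -- finite in number.
    refine Polynomial.eq_zero_of_infinite_isRoot P fun hfin => ?_
    have hnull : volume (Ioo (t i) (t (i + 1))) = 0 := by
      have h3 : ∀ᵐ x ∂volume, x ∈ Ioo (t i) (t (i + 1)) → x ∈ {x | P.IsRoot x} := by
        rw [leb01, Filter.EventuallyEq, ae_restrict_iff' measurableSet_Icc] at hproj
        filter_upwards [hproj] with x hx hxi
        have h4 := hx (ht.Ioo_subset (by omega) hi hxi)
        rw [← e] at h4
        change P.eval x = 0
        rw [hP, ← h.splineSum_eq _ hi (Ioo_subset_Ico_self hxi)]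
        simp only [sub_mul, Finset.sum_sub_distrib]
        rw [sub_eq_zero]
        simpa only [e, splineOp] using h4
      refine measure_mono_null_ae ?_ (hfin.measure_zero volume)
      exact h3
    rw [Real.volume_Ioo, ENNReal.ofReal_eq_zero] at hnull
    linarith [h.lt i hi]
  have := coeff_eq_zero_of_sum_bsplinePoly_eq_zero h.mono (show n ≤ n + i * d by omega)
    (show n + i * d < n + 1 + l * d by omega) (h.gap_pos hi) hzero (j := k) (by omega) (by omega)
  exact sub_eq_zero.1 this

theorem KnotLayout.integrable_splineBasis_mul (h : KnotLayout n d l t s)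
    (ht : IsAugmentedKnots (n + 1) l t) (hc : IsQuasiInterpolant (n + 1) d l t C c) {k j : ℕ}
    (hk : k < n + 1 + l * d) (hj : j < n + 1 + l * d) :
    Integrable (fun x => splineBasis (n + 1) d l t j x * c k x) leb01 := by
  have hci : Integrable (c k) leb01 :=
    memLp_one_iff_integrable.1 ((hc.memLp_top k hk).mono_exponent le_top)
  refine hci.bdd_mul (c := 1) (measurable_bspline _ _ _).aestronglyMeasurable ?_
  filter_upwards [ae_leb01_mem_Ioo ht] with x ⟨i, hi, hx⟩
  have hx' := Ioo_subset_Ico_self hx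
  rw [Real.norm_eq_abs, abs_of_nonneg (h.splineBasis_nonneg hi hj hx'),
    ← h.sum_splineBasis hi hx']
  exact Finset.single_le_sum
    (fun j hj => h.splineBasis_nonneg hi (Finset.mem_range.1 hj) hx') (Finset.mem_range.2 hj)

/-- The trace of the square of the projection, hence the square norm of the symmetrized kernel,
is at least the dimension of the spline space. -/
theorem KnotLayout.le_lintegral_symmetrize_sq (h : KnotLayout n d l t s) (hdn : d ≤ n + 1)
    (ht : IsAugmentedKnots (n + 1) l t) (hc : IsQuasiInterpolant (n + 1) d l t C c) :
    ENNReal.ofReal ((n + 1 + l * d : ℕ) : ℝ) ≤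
      ∫⁻ z, ENNReal.ofReal (symmetrize (splineKernel (n + 1) d l t c) z.1 z.2 ^ 2)
        ∂(leb01.prod leb01) := by
  set I := Finset.range (n + 1 + l * d) with hI
  set N := splineBasis (n + 1) d l t with hN
  set K := splineKernel (n + 1) d l t c with hK
  have e : ∀ z : ℝ × ℝ, K z.1 z.2 * K z.2 z.1 =
      ∑ k ∈ I, ∑ j ∈ I, (N k z.1 * c j z.1) * (N j z.2 * c k z.2) := by
    intro z
    simp only [hK, splineKernel]
    rw [Finset.sum_mul_sum]
    refine Finset.sum_congr rfl fun k _ => Finset.sum_congr rfl fun j _ => ?_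
    ring
  have hint : ∀ k ∈ I, ∀ j ∈ I, Integrable
      (fun z : ℝ × ℝ => (N k z.1 * c j z.1) * (N j z.2 * c k z.2)) (leb01.prod leb01) :=
    fun k hk j hj => Integrable.mul_prod
      (h.integrable_splineBasis_mul ht hc (Finset.mem_range.1 hj) (Finset.mem_range.1 hk))
      (h.integrable_splineBasis_mul ht hc (Finset.mem_range.1 hk) (Finset.mem_range.1 hj))
  have hKi : Integrable (fun z : ℝ × ℝ => K z.1 z.2 * K z.2 z.1) (leb01.prod leb01) := by
    simp only [e]
    exact integrable_finsetSum _ fun k hk => integrable_finsetSum _ fun j hj => hint k hk j hj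
  have hval : ∫ z : ℝ × ℝ, K z.1 z.2 * K z.2 z.1 ∂(leb01.prod leb01) =
      ((n + 1 + l * d : ℕ) : ℝ) := by
    simp only [e]
    rw [integral_finsetSum _ fun k hk => integrable_finsetSum _ fun j hj => hint k hk j hj]
    have : ∀ k ∈ I, ∫ z : ℝ × ℝ, ∑ j ∈ I, (N k z.1 * c j z.1) * (N j z.2 * c k z.2)
        ∂(leb01.prod leb01) = 1 := by
      intro k hk
      rw [integral_finsetSum _ fun j hj => hint k hk j hj]
      have h1 : ∀ j ∈ I, ∫ z : ℝ × ℝ, (N k z.1 * c j z.1) * (N j z.2 * c k z.2)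
          ∂(leb01.prod leb01) = if k = j then 1 else 0 := by
        intro j hj
        rw [integral_prod_mul (fun x => N k x * c j x) (fun y => N j y * c k y)]
        have h2 := h.coeffFunctional_splineBasis hdn ht hc (Finset.mem_range.1 hj)
          (Finset.mem_range.1 hk)
        have h3 := h.coeffFunctional_splineBasis hdn ht hc (Finset.mem_range.1 hk)
          (Finset.mem_range.1 hj)
        rw [coeffFunctional] at h2 h3
        rw [h2, h3]
        by_cases hkj : k = j <;> simp [hkj, eq_comm]
      rw [Finset.sum_congr rfl h1]
      simp [hk]
    rw [Finset.sum_congr rfl this]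
    simp [hI]
  rw [← hval]
  -- K(x,y)K(y,x) may be negative, so the passage to the `ℝ≥0∞` integral goes through its positive
  -- part.
  calc ENNReal.ofReal (∫ z : ℝ × ℝ, K z.1 z.2 * K z.2 z.1 ∂(leb01.prod leb01))
      ≤ ENNReal.ofReal (∫ z : ℝ × ℝ, max (K z.1 z.2 * K z.2 z.1) 0 ∂(leb01.prod leb01)) :=
        ENNReal.ofReal_le_ofReal (integral_mono hKi hKi.pos_part fun z => le_max_left _ _)
    _ = ∫⁻ z : ℝ × ℝ, ENNReal.ofReal (max (K z.1 z.2 * K z.2 z.1) 0) ∂(leb01.prod leb01) :=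
        ofReal_integral_eq_lintegral_ofReal hKi.pos_part
          (Eventually.of_forall fun z => le_max_right _ _)
    _ ≤ _ := by
        refine lintegral_mono fun z => ENNReal.ofReal_le_ofReal (max_le ?_ (sq_nonneg _))
        simp only [symmetrize]
        nlinarith [sq_nonneg (K z.1 z.2 - K z.2 z.1)]

end Kernel

/-! ### Kernels concentrated near the diagonal -/

theorem HasDensityBoundedAway.exists_bounds {G : Measure ℝ} (hG : HasDensityBoundedAway G) :
    ∃ g₁ g₂ : ℝ, 0 < g₁ ∧ 0 < g₂ ∧ ENNReal.ofReal g₁ • leb01 ≤ G ∧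
      G ≤ ENNReal.ofReal g₂ • leb01 := by
  obtain ⟨g, -, ⟨a, b, ha, hab⟩, rfl⟩ := hG
  have hb : 0 < b := ha.trans_le ((hab 0 (by simp)).1.trans (hab 0 (by simp)).2)
  refine ⟨a, b, ha, hb, ?_, ?_⟩
  · rw [← withDensity_const]
    refine withDensity_mono ?_
    filter_upwards [ae_leb01_mem] with x hx using ENNReal.ofReal_le_ofReal (hab x hx).1
  · rw [← withDensity_const]
    refine withDensity_mono ?_
    filter_upwards [ae_leb01_mem] with x hx using ENNReal.ofReal_le_ofReal (hab x hx).2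

/-- The pairs of points at distance at most `ε`. -/
def diagonalBand (ε : ℝ) : Set (ℝ × ℝ) := {z | |z.1 - z.2| ≤ ε}

theorem measurableSet_diagonalBand (ε : ℝ) : MeasurableSet (diagonalBand ε) :=
  measurableSet_le (by fun_prop) measurable_const

section Density

variable {G : Measure ℝ} {g₂ : ℝ}

theorem measure_Icc_le (hG : G ≤ ENNReal.ofReal g₂ • leb01) (hg : 0 < g₂) (u v : ℝ) :
    G (Icc u v) ≤ ENNReal.ofReal (g₂ * (v - u)) := by
  refine (hG _).trans ?_
  rw [Measure.smul_apply, smul_eq_mul, ENNReal.ofReal_mul hg.le, ← Real.volume_Icc]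
  exact mul_le_mul_right (Measure.restrict_apply_le _ _) _

theorem measure_near_le (hG : G ≤ ENNReal.ofReal g₂ • leb01) (hg : 0 < g₂) (x ε : ℝ) :
    G {y | |x - y| ≤ ε} ≤ ENNReal.ofReal (g₂ * (2 * ε)) := by
  have e : {y | |x - y| ≤ ε} = Icc (x - ε) (x + ε) := by
    ext y
    rw [mem_ofPred_eq, abs_le, mem_Icc]
    constructor <;> rintro ⟨h1, h2⟩ <;> constructor <;> linarith
  rw [e]
  refine (measure_Icc_le hG hg _ _).trans (le_of_eq ?_)
  congr 2
  ring

theorem measure_prod_band_le [SFinite G] (hG : G ≤ ENNReal.ofReal g₂ • leb01) (hg : 0 < g₂)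
    {A : Set ℝ} (hA : MeasurableSet A) (ε : ℝ) :
    (G.prod G) (A ×ˢ A ∩ diagonalBand ε) ≤ ENNReal.ofReal (g₂ * (2 * ε)) * G A := by
  rw [Measure.prod_apply ((hA.prod hA).inter (measurableSet_diagonalBand ε))]
  calc ∫⁻ x, G (Prod.mk x ⁻¹' (A ×ˢ A ∩ diagonalBand ε)) ∂G
      ≤ ∫⁻ x, A.indicator (fun _ => ENNReal.ofReal (g₂ * (2 * ε))) x ∂G := by
        refine lintegral_mono fun x => ?_
        by_cases hx : x ∈ A
        · rw [indicator_of_mem hx]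
          exact (measure_mono fun y hy => hy.2).trans (measure_near_le hG hg x ε)
        · rw [indicator_of_notMem hx]
          have : Prod.mk x ⁻¹' (A ×ˢ A ∩ diagonalBand ε) = ∅ := by
            ext y; simp [hx]
          simp [this]
    _ = _ := by rw [lintegral_indicator_const hA]

/-- Integrals of a weighted power of a bounded kernel that vanishes off a diagonal band. -/
theorem lintegral_weighted_rpow_le [SFinite G] {K : ℝ → ℝ → ℝ} {k ε : ℝ}
    (hK : ∀ᵐ z ∂(G.prod G), |K z.1 z.2| ≤ k ∧ (ε < |z.1 - z.2| → K z.1 z.2 = 0))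
    {m : ℝ → ℝ} {M : ℝ} (hm : ∀ᵐ x ∂G, 0 ≤ m x ∧ m x ≤ M) {p : ℝ} (hp : 0 < p)
    (W : Set (ℝ × ℝ)) :
    ∫⁻ z in W, ENNReal.ofReal (|K z.1 z.2| ^ p * (m z.1 * m z.2)) ∂(G.prod G) ≤
      ENNReal.ofReal (k ^ p * (M * M)) * (G.prod G) (W ∩ diagonalBand ε) := by
  have h1 : ∀ᵐ z ∂(G.prod G), 0 ≤ m z.1 ∧ m z.1 ≤ M :=
    Measure.quasiMeasurePreserving_fst.ae hm
  have h2 : ∀ᵐ z ∂(G.prod G), 0 ≤ m z.2 ∧ m z.2 ≤ M :=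
    Measure.quasiMeasurePreserving_snd.ae hm
  calc _ ≤ ∫⁻ z in W, (diagonalBand ε).indicator
        (fun _ => ENNReal.ofReal (k ^ p * (M * M))) z ∂(G.prod G) := by
        refine lintegral_mono_ae (ae_restrict_of_ae ?_)
        filter_upwards [hK, h1, h2] with z hz hz1 hz2
        by_cases hb : z ∈ diagonalBand ε
        · rw [indicator_of_mem hb]
          refine ENNReal.ofReal_le_ofReal ?_
          have hk0 := (abs_nonneg _).trans hz.1
          have hM0 := hz1.1.trans hz1.2
          exact mul_le_mul (Real.rpow_le_rpow (abs_nonneg _) hz.1 hp.le)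
            (mul_le_mul hz1.2 hz2.2 hz2.1 hM0) (mul_nonneg hz1.1 hz2.1) (by positivity)
        · rw [indicator_of_notMem hb, hz.2 (not_le.1 hb), abs_zero, Real.zero_rpow hp.ne',
            zero_mul, ENNReal.ofReal_zero]
    _ = _ := by
        rw [lintegral_indicator_const (measurableSet_diagonalBand ε),
          Measure.restrict_apply (measurableSet_diagonalBand ε), inter_comm]

theorem ae_prod_of_ae {S : Set ℝ} [SFinite G] (hG : G ≤ ENNReal.ofReal g₂ • leb01)
    (hS : ∀ᵐ x ∂leb01, x ∈ S) : ∀ᵐ z ∂(G.prod G), z.1 ∈ S ∧ z.2 ∈ S := by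
  have h : ∀ᵐ x ∂G, x ∈ S := (Measure.absolutelyContinuous_of_le_smul hG).ae_le hS
  filter_upwards [Measure.quasiMeasurePreserving_fst.ae h,
    Measure.quasiMeasurePreserving_snd.ae h] with z h1 h2 using ⟨h1, h2⟩

/-- Schur's test for a bounded kernel that vanishes off a diagonal band. -/
theorem kernelOpNorm_le [SFinite G] (hG : G ≤ ENNReal.ofReal g₂ • leb01) (hg : 0 < g₂)
    {K : ℝ → ℝ → ℝ} {k ε : ℝ} {S : Set ℝ} (hS : ∀ᵐ x ∂leb01, x ∈ S)
    (hK : ∀ x ∈ S, ∀ y ∈ S, |K x y| ≤ k ∧ (ε < |x - y| → K x y = 0)) :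
    kernelOpNorm G K ≤ ENNReal.ofReal k * ENNReal.ofReal (g₂ * (2 * ε)) := by
  have hSG : ∀ᵐ x ∂G, x ∈ S := (Measure.absolutelyContinuous_of_le_smul hG).ae_le hS
  refine iSup_le fun f => iSup_le fun hf => iSup_le fun hf1 => ?_
  set ρ := ENNReal.ofReal (g₂ * (2 * ε)) with hρ
  set κ := ENNReal.ofReal k with hκ
  set F : ℝ → ℝ≥0∞ := fun v => ‖f v‖ₑ with hF
  have hFm : AEMeasurable F G := hf.1.enorm
  have hF2 : ∫⁻ v, F v ^ (2 : ℝ) ∂G = 1 := by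
    rw [eLpNorm_eq_lintegral_rpow_enorm_toReal (by simp) (by simp)] at hf1
    simp only [ENNReal.toReal_ofNat] at hf1
    have := congrArg (fun u : ℝ≥0∞ => u ^ (2 : ℝ)) hf1
    simp only [ENNReal.one_rpow] at this
    rwa [← ENNReal.rpow_mul, show (1 / 2 : ℝ) * 2 = 1 by norm_num, ENNReal.rpow_one] at this
  set J : ℝ → Set ℝ := fun x => {y | |x - y| ≤ ε} with hJ
  have hJm : ∀ x, MeasurableSet (J x) := fun x => measurableSet_le (by fun_prop) measurable_const
  have h1 : ∀ᵐ x ∂G, ‖kernelOp G K f x‖ₑ ^ (2 : ℝ) ≤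
      κ ^ (2 : ℝ) * ρ * ∫⁻ v, (J x).indicator (fun v => F v ^ (2 : ℝ)) v ∂G := by
    filter_upwards [hSG] with x hx
    have e1 : ‖kernelOp G K f x‖ₑ ≤ κ * ∫⁻ v in J x, F v ∂G := by
      rw [← lintegral_indicator (hJm x), ← lintegral_const_mul' _ _ ENNReal.ofReal_ne_top]
      refine (enorm_integral_le_lintegral_enorm _).trans (lintegral_mono_ae ?_)
      filter_upwards [hSG] with v hv
      rw [enorm_mul]
      obtain ⟨h2, h3⟩ := hK x hx v hv
      by_cases hxv : v ∈ J x
      · rw [indicator_of_mem hxv, mul_comm]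
        gcongr
        rw [← ofReal_norm]
        exact ENNReal.ofReal_le_ofReal h2
      · rw [h3 (not_le.1 hxv)]
        simp
    -- Cauchy–Schwarz against the constant 1 on the band around x yields one factor ρ after
    -- squaring.
    have e2 : ∫⁻ v in J x, F v ∂G ≤
        (∫⁻ v in J x, F v ^ (2 : ℝ) ∂G) ^ (1 / 2 : ℝ) * ρ ^ (1 / 2 : ℝ) := by
      have := ENNReal.lintegral_mul_le_Lp_mul_Lq (G.restrict (J x)) Real.HolderConjugate.two_two
        hFm.restrict (aemeasurable_const (b := (1 : ℝ≥0∞)))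
      simp only [Pi.mul_apply, mul_one, ENNReal.one_rpow, lintegral_one,
        Measure.restrict_apply_univ] at this
      refine this.trans ?_
      gcongr
      exact measure_near_le hG hg x ε
    rw [lintegral_indicator (hJm x)]
    calc ‖kernelOp G K f x‖ₑ ^ (2 : ℝ)
        ≤ (κ * ((∫⁻ v in J x, F v ^ (2 : ℝ) ∂G) ^ (1 / 2 : ℝ) * ρ ^ (1 / 2 : ℝ))) ^ (2 : ℝ) := by
          gcongr
          exact e1.trans (by gcongr)
      _ = _ := by
          rw [ENNReal.mul_rpow_of_nonneg _ _ (by norm_num),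
            ENNReal.mul_rpow_of_nonneg _ _ (by norm_num), ← ENNReal.rpow_mul, ← ENNReal.rpow_mul,
            show (1 / 2 : ℝ) * 2 = 1 by norm_num, ENNReal.rpow_one, ENNReal.rpow_one]
          ring
  -- Symmetry of the band and Tonelli give the second factor ρ.
  have h2 : ∫⁻ x, ∫⁻ v, (J x).indicator (fun v => F v ^ (2 : ℝ)) v ∂G ∂G ≤ ρ := by
    have hswap := lintegral_lintegral_swap (μ := G) (ν := G)
      (f := fun x v => (J x).indicator (fun v => F v ^ (2 : ℝ)) v) (by
        have : (Function.uncurry fun x v => (J x).indicator (fun v => F v ^ (2 : ℝ)) v) =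
            (diagonalBand ε).indicator fun z => F z.2 ^ (2 : ℝ) := by
          funext z
          rfl
        rw [this]
        refine AEMeasurable.indicator ?_ (measurableSet_diagonalBand ε)
        exact (hFm.comp_quasiMeasurePreserving Measure.quasiMeasurePreserving_snd).pow_const _)
    rw [hswap]
    calc ∫⁻ v, ∫⁻ x, (J x).indicator (fun v => F v ^ (2 : ℝ)) v ∂G ∂G
        ≤ ∫⁻ v, ρ * F v ^ (2 : ℝ) ∂G := by
          refine lintegral_mono fun v => ?_
          have e : ∀ x, (J x).indicator (fun v => F v ^ (2 : ℝ)) v =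
              (J v).indicator (fun _ => F v ^ (2 : ℝ)) x := by
            intro x
            have : v ∈ J x ↔ x ∈ J v := by simp only [hJ, mem_ofPred_eq, abs_sub_comm]
            by_cases hxv : v ∈ J x
            · rw [indicator_of_mem hxv, indicator_of_mem (this.1 hxv)]
            · rw [indicator_of_notMem hxv, indicator_of_notMem (this.not.1 hxv)]
          simp only [e]
          rw [lintegral_indicator_const (hJm v), mul_comm]
          gcongr
          exact measure_near_le hG hg v ε
      _ = ρ := by rw [lintegral_const_mul' _ _ ENNReal.ofReal_ne_top, hF2, mul_one]
  rw [eLpNorm_eq_lintegral_rpow_enorm_toReal (by simp) (by simp)]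
  simp only [ENNReal.toReal_ofNat]
  have h3 : ∫⁻ x, ‖kernelOp G K f x‖ₑ ^ (2 : ℝ) ∂G ≤ (κ * ρ) ^ (2 : ℝ) := by
    refine (lintegral_mono_ae h1).trans ?_
    rw [lintegral_const_mul' _ _ (ENNReal.mul_ne_top
      (ENNReal.rpow_ne_top_of_nonneg (by norm_num) ENNReal.ofReal_ne_top) ENNReal.ofReal_ne_top),
      ENNReal.mul_rpow_of_nonneg _ _ (by norm_num)]
    calc κ ^ (2 : ℝ) * ρ * ∫⁻ x, ∫⁻ v, (J x).indicator (fun v => F v ^ (2 : ℝ)) v ∂G ∂G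
        ≤ κ ^ (2 : ℝ) * ρ * ρ := by gcongr
      _ = _ := by
        rw [mul_assoc]
        congr 1
        rw [← sq, ← ENNReal.rpow_natCast]
        norm_num
  calc _ ≤ ((κ * ρ) ^ (2 : ℝ)) ^ (1 / 2 : ℝ) := by gcongr
    _ = κ * ρ := by rw [← ENNReal.rpow_mul, show (2 : ℝ) * (1 / 2) = 1 by norm_num, ENNReal.rpow_one]

end Density

/-! ### Equidistant partitions -/

/-- The index of the interval of the partition in `N + 1` intervals of equal length. -/
noncomputable def cellIndex (N : ℕ) (x : ℝ) : ℕ := min ⌊x * (N + 1)⌋₊ N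

/-- The intervals of the equidistant partition. -/
noncomputable def cell (N : ℕ) (m : Fin (N + 1)) : Set ℝ := Icc 0 1 ∩ {x | cellIndex N x = m}

theorem measurable_cellIndex (N : ℕ) : Measurable (cellIndex N) :=
  (Nat.measurable_floor.comp (by fun_prop)).min measurable_const

theorem isMeasurablePartition_cell (N : ℕ) : IsMeasurablePartition (cell N) where
  measurableSet m := measurableSet_Icc.inter
    (measurable_cellIndex N (MeasurableSet.singleton (m : ℕ)))
  disjoint := by
    intro m m' hmm'
    rw [Function.onFun, Set.disjoint_left]
    rintro x ⟨-, hx⟩ ⟨-, hx'⟩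
    rw [mem_ofPred_eq] at hx hx'
    exact hmm' (Fin.ext (hx.symm.trans hx'))
  iUnion_eq := by
    ext x
    simp only [cell, mem_iUnion, mem_inter_iff, mem_ofPred_eq]
    constructor
    · rintro ⟨m, hx, -⟩
      exact hx
    · intro hx
      exact ⟨⟨cellIndex N x, by unfold cellIndex; omega⟩, hx, rfl⟩

theorem cell_subset (N : ℕ) (m : Fin (N + 1)) :
    cell N m ⊆ Icc ((m : ℝ) / (N + 1)) ((m + 1 : ℝ) / (N + 1)) := by
  rintro x ⟨hx, hm⟩
  rw [mem_ofPred_eq, cellIndex] at hm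
  have hN : (0 : ℝ) < N + 1 := by positivity
  have h0 : 0 ≤ x * (N + 1) := mul_nonneg hx.1 hN.le
  have hfl := Nat.floor_le h0
  constructor
  · rw [div_le_iff₀ hN]
    refine le_trans ?_ hfl
    have : (m : ℕ) ≤ ⌊x * (N + 1)⌋₊ := by omega
    exact_mod_cast this
  · rw [le_div_iff₀ hN]
    rcases lt_or_ge ⌊x * ((N : ℝ) + 1)⌋₊ (N + 1) with h | h
    · have h1 : ⌊x * ((N : ℝ) + 1)⌋₊ = m := by omega
      rw [← h1]
      exact (Nat.lt_floor_add_one _).le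
    -- Within [0,1] this is the case x = 1, which the minimum in `cellIndex` puts in the last cell.
    · have h1 : (m : ℕ) = N := by omega
      rw [h1]
      exact mul_le_of_le_one_left hN.le hx.2

theorem Ico_subset_cell (N : ℕ) (m : Fin (N + 1)) :
    Ico ((m : ℝ) / (N + 1)) ((m + 1 : ℝ) / (N + 1)) ⊆ cell N m := by
  rintro x ⟨h1, h2⟩
  have hN : (0 : ℝ) < N + 1 := by positivity
  rw [div_le_iff₀ hN] at h1
  rw [lt_div_iff₀ hN] at h2
  have hm : ((m : ℕ) : ℝ) + 1 ≤ N + 1 := by exact_mod_cast m.2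
  have h0 : 0 ≤ x * (N + 1) := (Nat.cast_nonneg _).trans h1
  have hfl : ⌊x * ((N : ℝ) + 1)⌋₊ = m := by
    rw [Nat.floor_eq_iff h0]
    exact ⟨h1, h2⟩
  refine ⟨⟨nonneg_of_mul_nonneg_left h0 hN, ?_⟩, ?_⟩
  · by_contra hx
    have := (lt_mul_iff_one_lt_left hN).2 (not_le.1 hx)
    linarith
  · rw [mem_ofPred_eq, cellIndex, hfl]
    exact min_eq_left (by omega)

theorem measure_cell_le {G : Measure ℝ} {g₂ : ℝ} (hG : G ≤ ENNReal.ofReal g₂ • leb01)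
    (hg : 0 < g₂) (N : ℕ) (m : Fin (N + 1)) : G (cell N m) ≤ ENNReal.ofReal (g₂ / (N + 1)) := by
  refine (measure_mono (cell_subset N m)).trans ((measure_Icc_le hG hg _ _).trans (le_of_eq ?_))
  congr 1
  field_simp
  ring

theorem le_measure_cell {G : Measure ℝ} {g₁ : ℝ} (hG : ENNReal.ofReal g₁ • leb01 ≤ G)
    (hg : 0 < g₁) (N : ℕ) (m : Fin (N + 1)) : ENNReal.ofReal (g₁ / (N + 1)) ≤ G (cell N m) := by
  refine le_trans ?_ (hG _)
  rw [Measure.smul_apply, smul_eq_mul, div_eq_mul_inv, ENNReal.ofReal_mul hg.le]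
  gcongr
  have h1 : leb01 (cell N m) = volume (cell N m) :=
    Measure.restrict_eq_self _ inter_subset_left
  rw [h1]
  refine le_trans (le_of_eq ?_) (measure_mono (Ico_subset_cell N m))
  rw [Real.volume_Ico]
  congr 1
  field_simp
  ring

/-- The left endpoint of the cell of the larger point separates the two points, hence is within ε of
both. -/
theorem exists_near_breakpoint {N : ℕ} {x y ε : ℝ} (hx : x ∈ Icc (0 : ℝ) 1)
    (hy : y ∈ Icc (0 : ℝ) 1) (hxy : |x - y| ≤ ε) (hne : cellIndex N x ≠ cellIndex N y) :
    ∃ i ∈ Finset.range (N + 1), |(i : ℝ) / (N + 1) - x| ≤ ε ∧ |(i : ℝ) / (N + 1) - y| ≤ ε := by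
  wlog hlt : cellIndex N x < cellIndex N y generalizing x y
  · obtain ⟨i, hi, h1, h2⟩ := this hy hx (by rwa [abs_sub_comm]) hne.symm (by omega)
    exact ⟨i, hi, h2, h1⟩
  have hN : (0 : ℝ) < N + 1 := by positivity
  unfold cellIndex at hlt
  set i := min ⌊y * ((N : ℝ) + 1)⌋₊ N with hi
  have h1 : x < (i : ℝ) / (N + 1) := by
    rw [lt_div_iff₀ hN, ← Nat.floor_lt (mul_nonneg hx.1 hN.le)]
    omega
  have h2 : (i : ℝ) / (N + 1) ≤ y := by
    rw [div_le_iff₀ hN]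
    refine le_trans ?_ (Nat.floor_le (mul_nonneg hy.1 hN.le))
    exact Nat.cast_le.2 (min_le_left _ _)
  have h3 := (abs_le.1 hxy).1
  refine ⟨i, by rw [Finset.mem_range]; omega, ?_, ?_⟩ <;> rw [abs_le] <;> constructor <;> linarith

/-- Up to a null set, the part of the band outside the diagonal blocks is covered by N + 1 squares
of half-width ε around the breakpoints. -/
theorem measure_offDiagonal_band_le {G : Measure ℝ} [SFinite G] {g₂ : ℝ}
    (hG : G ≤ ENNReal.ofReal g₂ • leb01) (hg : 0 < g₂) (N : ℕ) (ε : ℝ) :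
    (G.prod G) ((⋃ m, cell N m ×ˢ cell N m)ᶜ ∩ diagonalBand ε) ≤
      ((N + 1 : ℕ) : ℝ≥0∞) * (ENNReal.ofReal (g₂ * (2 * ε)) * ENNReal.ofReal (g₂ * (2 * ε))) := by
  set J : ℝ → Set ℝ := fun x => {y | |x - y| ≤ ε} with hJ
  have hae : ∀ᵐ z ∂(G.prod G), z ∈ (⋃ m, cell N m ×ˢ cell N m)ᶜ ∩ diagonalBand ε →
      z ∈ ⋃ i ∈ Finset.range (N + 1), J ((i : ℝ) / (N + 1)) ×ˢ J ((i : ℝ) / (N + 1)) := by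
    filter_upwards [ae_prod_of_ae hG ae_leb01_mem] with z hz hz'
    have hne : cellIndex N z.1 ≠ cellIndex N z.2 := by
      intro he
      refine hz'.1 (mem_iUnion.2 ⟨⟨cellIndex N z.1, by unfold cellIndex; omega⟩, ?_, ?_⟩)
      · exact ⟨hz.1, rfl⟩
      · exact ⟨hz.2, he.symm⟩
    obtain ⟨i, hi, h1, h2⟩ := exists_near_breakpoint hz.1 hz.2 hz'.2 hne
    exact mem_biUnion hi ⟨h1, h2⟩
  refine (measure_mono_ae hae).trans ((measure_biUnion_finset_le _ _).trans ?_)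
  calc ∑ i ∈ Finset.range (N + 1),
        (G.prod G) (J ((i : ℝ) / (N + 1)) ×ˢ J ((i : ℝ) / (N + 1)))
      ≤ ∑ i ∈ Finset.range (N + 1),
        (ENNReal.ofReal (g₂ * (2 * ε)) * ENNReal.ofReal (g₂ * (2 * ε))) := by
        refine Finset.sum_le_sum fun i _ => ?_
        rw [Measure.prod_prod]
        gcongr <;> exact measure_near_le hG hg _ ε
    _ = _ := by rw [Finset.sum_const, Finset.card_range, nsmul_eq_mul]

/-! ### Verification of the kernel conditions -/

theorem BoundedAndAway.exists_bounds {G : Measure ℝ} {m : ℝ → ℝ} (h : BoundedAndAway G m) :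
    ∃ a M : ℝ, 0 < a ∧ 0 < M ∧ (∀ᵐ x ∂G, a ≤ m x) ∧ ∀ᵐ x ∂G, 0 ≤ m x ∧ m x ≤ M := by
  obtain ⟨a, b, ha, h⟩ := h
  refine ⟨a, max b 1, ha, by positivity, h.mono fun x hx => hx.1, h.mono fun x hx => ?_⟩
  exact ⟨ha.le.trans hx.1, hx.2.trans (le_max_left _ _)⟩

theorem le_kernelSize {G : Measure ℝ} [SFinite G] {g₁ : ℝ} (hG : ENNReal.ofReal g₁ • leb01 ≤ G)
    {m : ℝ → ℝ} {a : ℝ} (ha : 0 < a) (hm : ∀ᵐ x ∂G, a ≤ m x) (K : ℝ → ℝ → ℝ) :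
    ENNReal.ofReal (a * a) * (ENNReal.ofReal g₁ * (ENNReal.ofReal g₁ *
      ∫⁻ z, ENNReal.ofReal (K z.1 z.2 ^ 2) ∂(leb01.prod leb01))) ≤ kernelSize G m K := by
  have h1 : ∀ᵐ z ∂(G.prod G), a ≤ m z.1 := Measure.quasiMeasurePreserving_fst.ae hm
  have h2 : ∀ᵐ z ∂(G.prod G), a ≤ m z.2 := Measure.quasiMeasurePreserving_snd.ae hm
  have h3 : ENNReal.ofReal g₁ * (ENNReal.ofReal g₁ *
      ∫⁻ z, ENNReal.ofReal (K z.1 z.2 ^ 2) ∂(leb01.prod leb01)) ≤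
      ∫⁻ z, ENNReal.ofReal (K z.1 z.2 ^ 2) ∂(G.prod G) := by
    refine le_trans (le_of_eq ?_) (lintegral_mono' (Measure.prod_mono hG hG) le_rfl)
    rw [Measure.prod_smul_left, Measure.prod_smul_right, lintegral_smul_measure,
      lintegral_smul_measure, smul_eq_mul, smul_eq_mul]
  rw [kernelSize, blockMoment, univ_prod_univ, Measure.restrict_univ]
  calc _ ≤ ENNReal.ofReal (a * a) * ∫⁻ z, ENNReal.ofReal (K z.1 z.2 ^ 2) ∂(G.prod G) := by gcongr
    _ = ∫⁻ z, ENNReal.ofReal (a * a) * ENNReal.ofReal (K z.1 z.2 ^ 2) ∂(G.prod G) :=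
        (lintegral_const_mul' _ _ ENNReal.ofReal_ne_top).symm
    _ ≤ _ := by
        refine lintegral_mono_ae ?_
        filter_upwards [h1, h2] with z hz1 hz2
        rw [← ENNReal.ofReal_mul (by positivity), Real.rpow_two, sq_abs, mul_comm]
        refine ENNReal.ofReal_le_ofReal (mul_le_mul_of_nonneg_left ?_ (sq_nonneg _))
        exact mul_le_mul hz1 hz2 ha.le (ha.le.trans hz1)

theorem tendsto_succ_div_zero {L : ℕ → ℝ} (hL : ∀ n, 0 < L n)
    (h : Tendsto (fun n : ℕ => L n / n) atTop atTop) :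
    Tendsto (fun n : ℕ => ((n : ℝ) + 1) / L n) atTop (𝓝 0) := by
  have h1 : Tendsto (fun n : ℕ => 2 * ((n : ℝ) / L n)) atTop (𝓝 0) := by
    have := (tendsto_inv_atTop_zero.comp h).const_mul 2
    rw [mul_zero] at this
    refine this.congr fun n => ?_
    simp
  refine squeeze_zero' (Eventually.of_forall fun n => div_nonneg (by positivity) (hL n).le) ?_ h1
  filter_upwards [eventually_ge_atTop 1] with n hn
  rw [mul_div_assoc']
  have : (1 : ℝ) ≤ n := by exact_mod_cast hn
  exact div_le_div_of_nonneg_right (by linarith) (hL n).le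

/-- Kernels of size `O(L n)` that vanish at distance `O(1 / L n)` from the diagonal and have square
norm of the order `L n`, with `n ≪ L n ≪ n ^ 2`, satisfy the conditions. -/
theorem kernelConditions_of_band {G : Measure ℝ} [IsProbabilityMeasure G]
    (hG : HasDensityBoundedAway G) {q : ℝ} (hq : 2 < q) {μ₂ μq : ℝ → ℝ}
    (hμ₂ : BoundedAndAway G μ₂) (hμq : BoundedAndAway G μq) {K : ℕ → ℝ → ℝ → ℝ}
    (hsymm : ∀ n x y, K n x y = K n y x) (hmeas : ∀ n, Measurable (Function.uncurry (K n)))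
    {L : ℕ → ℝ} (hL : ∀ n, 0 < L n) (htop : Tendsto (fun n : ℕ => L n / n) atTop atTop)
    (hzero : Tendsto (fun n : ℕ => L n / (n : ℝ) ^ 2) atTop (𝓝 0)) {A B : ℝ} (hA : 0 < A)
    (hB : 0 < B)
    (hband : ∀ n, ∃ S : Set ℝ, (∀ᵐ x ∂leb01, x ∈ S) ∧ ∀ x ∈ S, ∀ y ∈ S,
      |K n x y| ≤ A * L n ∧ (B / L n < |x - y| → K n x y = 0))
    (hlow : ∀ n, ENNReal.ofReal (L n) ≤
      ∫⁻ z, ENNReal.ofReal (K n z.1 z.2 ^ 2) ∂(leb01.prod leb01)) :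
    KernelConditions G μ₂ μq q K := by
  obtain ⟨g₁, g₂, hg₁, hg₂, hG₁, hG₂⟩ := hG.exists_bounds
  obtain ⟨a₂, M₂, ha₂, hM₂, hal₂, hMu₂⟩ := hμ₂.exists_bounds
  obtain ⟨-, Mq, -, hMq, -, hMuq⟩ := hμq.exists_bounds
  have hKae : ∀ n, ∀ᵐ z ∂(G.prod G), |K n z.1 z.2| ≤ A * L n ∧
      (B / L n < |z.1 - z.2| → K n z.1 z.2 = 0) := by
    intro n
    obtain ⟨S, hS, h⟩ := hband n
    filter_upwards [ae_prod_of_ae hG₂ hS] with z hz using h _ hz.1 _ hz.2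
  have hq0 : 0 < q := by linarith
  set c₁ : ℝ := a₂ * a₂ * (g₁ * g₁) with hc₁
  have hc₁0 : 0 < c₁ := by positivity
  have hsize_low : ∀ n, ENNReal.ofReal (c₁ * L n) ≤ kernelSize G μ₂ (K n) := by
    intro n
    refine le_trans ?_ (le_kernelSize hG₁ ha₂ hal₂ (K n))
    have h1 : ENNReal.ofReal (c₁ * L n) = ENNReal.ofReal (a₂ * a₂) *
        (ENNReal.ofReal g₁ * (ENNReal.ofReal g₁ * ENNReal.ofReal (L n))) := by
      rw [← ENNReal.ofReal_mul hg₁.le, ← ENNReal.ofReal_mul hg₁.le,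
        ← ENNReal.ofReal_mul (by positivity), hc₁]
      congr 1
      ring
    rw [h1]
    gcongr
    exact hlow n
  have hcL : ∀ n, 0 < c₁ * L n := fun n => mul_pos hc₁0 (hL n)
  have hsize_ne_zero : ∀ n, kernelSize G μ₂ (K n) ≠ 0 := fun n =>
    ((ENNReal.ofReal_pos.2 (hcL n)).trans_le (hsize_low n)).ne'
  -- Height to the power p, times band width, times the mass of the set.
  have hblock : ∀ (n : ℕ) (p : ℝ) (m : ℝ → ℝ) (M : ℝ), 0 < p → 0 < M →
      (∀ᵐ x ∂G, 0 ≤ m x ∧ m x ≤ M) → ∀ E : Set ℝ, MeasurableSet E → ∀ g : ℝ, 0 ≤ g →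
      G E ≤ ENNReal.ofReal g → blockMoment G p m (K n) E ≤
        ENNReal.ofReal ((A * L n) ^ p * (M * M) * (g₂ * (2 * (B / L n)) * g)) := by
    intro n p m M hp hM hm E hE g hg hEg
    have hAL := mul_pos hA (hL n)
    have hBL := div_pos hB (hL n)
    rw [ENNReal.ofReal_mul (by positivity), ENNReal.ofReal_mul (p := g₂ * (2 * (B / L n)))
      (by positivity)]
    refine (lintegral_weighted_rpow_le (hKae n) hm hp _).trans ?_
    gcongr
    refine (measure_prod_band_le hG₂ hg₂ hE _).trans ?_
    gcongr
  have hsize_ne_top : ∀ n, kernelSize G μ₂ (K n) ≠ ∞ := fun n =>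
    ((hblock n 2 μ₂ M₂ two_pos hM₂ hMu₂ univ MeasurableSet.univ 1 zero_le_one
      (by simp)).trans_lt ENNReal.ofReal_lt_top).ne
  have hcell : ∀ (n : ℕ) (p : ℝ) (m : ℝ → ℝ) (M : ℝ), 0 < p → 0 < M →
      (∀ᵐ x ∂G, 0 ≤ m x ∧ m x ≤ M) → ∀ i : Fin (n + 1),
      blockMoment G p m (K n) (cell n i) ≤
        ENNReal.ofReal ((A * L n) ^ p * (M * M) * (g₂ * (2 * (B / L n)) * (g₂ / (n + 1)))) :=
    fun n p m M hp hM hm i => hblock n p m M hp hM hm _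
      ((isMeasurablePartition_cell n).measurableSet i) _ (by positivity) (measure_cell_le hG₂ hg₂ n i)
  have hsucc := tendsto_succ_div_zero hL htop
  have hinv : Tendsto (fun n : ℕ => ((n : ℝ) + 1)⁻¹) atTop (𝓝 0) :=
    tendsto_inv_atTop_zero.comp (tendsto_atTop_add_const_right _ _ tendsto_natCast_atTop_atTop)
  -- Using n + 1 cells keeps the partition nonempty at n = 0.
  refine ⟨hsymm, hmeas, fun n => ?_, ?_, ?_, fun n => n + 1, fun n => cell n,
    isMeasurablePartition_cell, ?_, ?_, ?_, ?_, ?_⟩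
  · have h1 := lintegral_weighted_rpow_le (hKae n) (m := fun _ => 1) (M := 1)
      (Eventually.of_forall fun _ => ⟨zero_le_one, le_rfl⟩) two_pos univ
    simp only [mul_one, Real.rpow_two, sq_abs, Measure.restrict_univ] at h1
    refine h1.trans_lt (ENNReal.mul_lt_top ENNReal.ofReal_lt_top (measure_lt_top _ _))
  · refine lt_of_le_of_lt (iSup_le fun n => ?_)
      (ENNReal.ofReal_lt_top (r := A * (g₂ * (2 * B))))
    obtain ⟨S, hS, h⟩ := hband n
    refine (kernelOpNorm_le hG₂ hg₂ hS h).trans (le_of_eq ?_)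
    rw [← ENNReal.ofReal_mul (mul_pos hA (hL n)).le]
    congr 1
    have := (hL n).ne'
    field_simp
  · refine tendsto_nhds_top_mono (ENNReal.tendsto_ofReal_nhds_top.2 (htop.const_mul_atTop hc₁0)) ?_
    filter_upwards [eventually_ge_atTop 1] with n hn
    have hn' : (0 : ℝ) < n := by exact_mod_cast hn
    rw [mul_div_assoc', ENNReal.ofReal_div_of_pos hn', ENNReal.ofReal_natCast]
    exact ENNReal.div_le_div_right (hsize_low n) _
  -- Off the diagonal blocks there are n + 1 squares of area O(L⁻²) on which the squared kernel is
  -- O(L²). Their mass O(n + 1) is negligible against a total of order L.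
  · set c₄ : ℝ := A ^ 2 * (M₂ * M₂) * (g₂ * (2 * B)) ^ 2 with hc₄
    set w : ℕ → ℝ := fun n => c₄ / c₁ * (((n : ℝ) + 1) / L n) with hw
    have hw0 : Tendsto w atTop (𝓝 0) := by simpa using hsucc.const_mul (c₄ / c₁)
    have hsplit : ∀ n, kernelSize G μ₂ (K n) =
        (∑ m, blockMoment G 2 μ₂ (K n) (cell n m)) +
          ∫⁻ z in (⋃ m, cell n m ×ˢ cell n m)ᶜ,
            ENNReal.ofReal (|K n z.1 z.2| ^ (2 : ℝ) * (μ₂ z.1 * μ₂ z.2)) ∂(G.prod G) := by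
      intro n
      have hm : ∀ m, MeasurableSet (cell n m ×ˢ cell n m) := fun m =>
        ((isMeasurablePartition_cell n).measurableSet m).prod
          ((isMeasurablePartition_cell n).measurableSet m)
      have hd : Pairwise (Function.onFun Disjoint fun m => cell n m ×ˢ cell n m) :=
        fun m m' hmm' => Set.disjoint_prod.2 (Or.inl ((isMeasurablePartition_cell n).disjoint hmm'))
      rw [kernelSize, blockMoment, univ_prod_univ, Measure.restrict_univ,
        ← lintegral_add_compl _ (MeasurableSet.iUnion hm), lintegral_iUnion hm hd, tsum_fintype]
      rfl
    have hoff : ∀ n, kernelSize G μ₂ (K n) ≤ (∑ m, blockMoment G 2 μ₂ (K n) (cell n m)) +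
        ENNReal.ofReal (c₄ * ((n : ℝ) + 1)) := by
      intro n
      rw [hsplit n]
      gcongr
      refine (lintegral_weighted_rpow_le (hKae n) hMu₂ two_pos _).trans ?_
      have hAL := mul_pos hA (hL n)
      have hBL := div_pos hB (hL n)
      refine (mul_le_mul_right (measure_offDiagonal_band_le hG₂ hg₂ n _) _).trans (le_of_eq ?_)
      rw [← ENNReal.ofReal_natCast, ← ENNReal.ofReal_mul (by positivity),
        ← ENNReal.ofReal_mul (by positivity), ← ENNReal.ofReal_mul (by positivity), hc₄,
        Real.rpow_two]
      congr 1
      have := (hL n).ne'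
      push_cast
      field_simp
    have hlow' : ∀ n, 1 - ENNReal.ofReal (w n) ≤
        (∑ m, blockMoment G 2 μ₂ (K n) (cell n m)) / kernelSize G μ₂ (K n) := by
      intro n
      rw [tsub_le_iff_right]
      calc (1 : ℝ≥0∞) = kernelSize G μ₂ (K n) / kernelSize G μ₂ (K n) :=
            (ENNReal.div_self (hsize_ne_zero n) (hsize_ne_top n)).symm
        _ ≤ ((∑ m, blockMoment G 2 μ₂ (K n) (cell n m)) + ENNReal.ofReal (c₄ * ((n : ℝ) + 1))) /
              kernelSize G μ₂ (K n) := ENNReal.div_le_div_right (hoff n) _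
        _ = (∑ m, blockMoment G 2 μ₂ (K n) (cell n m)) / kernelSize G μ₂ (K n) +
              ENNReal.ofReal (c₄ * ((n : ℝ) + 1)) / kernelSize G μ₂ (K n) := ENNReal.add_div
        _ ≤ _ := by
            gcongr
            refine (ENNReal.div_le_div_left (hsize_low n) _).trans (le_of_eq ?_)
            rw [← ENNReal.ofReal_div_of_pos (hcL n)]
            congr 1
            simp only [hw]
            have := (hL n).ne'
            field_simp
    have hup : ∀ n, (∑ m, blockMoment G 2 μ₂ (K n) (cell n m)) / kernelSize G μ₂ (K n) ≤ 1 := by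
      intro n
      refine ENNReal.div_le_of_le_mul ?_
      rw [one_mul, hsplit n]
      exact le_self_add
    have hlim : Tendsto (fun n => 1 - ENNReal.ofReal (w n)) atTop (𝓝 1) := by
      have := ENNReal.Tendsto.sub (tendsto_const_nhds (x := (1 : ℝ≥0∞)) (f := atTop))
        (ENNReal.tendsto_ofReal hw0) (Or.inl ENNReal.one_ne_top)
      simpa using this
    exact tendsto_of_tendsto_of_tendsto_of_le_of_le hlim tendsto_const_nhds hlow' hup
  -- One block has mass O(L² · L⁻¹ · (n + 1)⁻¹), against a total of order L.
  · set c₅ : ℝ := A ^ 2 * (M₂ * M₂) * (g₂ * (2 * B) * g₂) / c₁ with hc₅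
    have hlim : Tendsto (fun n : ℕ => ENNReal.ofReal (c₅ * ((n : ℝ) + 1)⁻¹)) atTop (𝓝 0) := by
      have := ENNReal.tendsto_ofReal (hinv.const_mul c₅)
      simpa using this
    refine tendsto_of_tendsto_of_tendsto_of_le_of_le tendsto_const_nhds hlim
      (fun n => zero_le) fun n => ?_
    refine (ENNReal.div_le_div (iSup_le fun m => hcell n 2 μ₂ M₂ two_pos hM₂ hMu₂ m)
      (hsize_low n)).trans (le_of_eq ?_)
    rw [← ENNReal.ofReal_div_of_pos (hcL n), Real.rpow_two]
    congr 1
    have := (hL n).ne'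
    simp only [hc₅]
    field_simp
  · have hlim : Tendsto (fun n : ℕ => ENNReal.ofReal (g₂ * ((n : ℝ) + 1)⁻¹)) atTop (𝓝 0) := by
      have := ENNReal.tendsto_ofReal (hinv.const_mul g₂)
      simpa using this
    exact tendsto_of_tendsto_of_tendsto_of_le_of_le tendsto_const_nhds hlim
      (fun n => zero_le) fun n => iSup_le fun m => measure_cell_le hG₂ hg₂ n m
  · refine (ENNReal.ofReal_pos.2 (half_pos hg₁)).trans_le (le_liminf_of_le ?_ ?_)
    · isBoundedDefault
    filter_upwards [eventually_ge_atTop 1] with n hn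
    have hn' : (1 : ℝ) ≤ n := by exact_mod_cast hn
    calc ENNReal.ofReal (g₁ / 2) ≤ ENNReal.ofReal (n * (g₁ / (n + 1))) := by
          refine ENNReal.ofReal_le_ofReal ?_
          rw [mul_div_assoc', div_le_div_iff₀ two_pos (by positivity)]
          nlinarith
      _ = (n : ℝ≥0∞) * ENNReal.ofReal (g₁ / (n + 1)) := by
          rw [ENNReal.ofReal_mul (by positivity), ENNReal.ofReal_natCast]
      _ ≤ _ := by
          gcongr
          exact le_iInf fun m => le_measure_cell hG₁ hg₁ n m
  -- The blocks together contribute O(L^{q-1}), the cell probabilities O(n^{-2θ}), and the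
  -- denominator has order L^{q/2}. As q - 1 - q/2 = θ, the quotient is O((L/n²)^θ).
  · set θ : ℝ := q / 2 - 1 with hθ
    have hθ0 : 0 < θ := by rw [hθ]; linarith
    set c₆ : ℝ := g₂ ^ θ * (A ^ q * (Mq * Mq) * (g₂ * (2 * B) * g₂)) / c₁ ^ (q / 2) with hc₆
    have hlim : Tendsto (fun n : ℕ => ENNReal.ofReal (c₆ * (L n / (n : ℝ) ^ 2) ^ θ)) atTop
        (𝓝 0) := by
      have h1 := (hzero.rpow_const (p := θ) (Or.inr hθ0.le)).const_mul c₆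
      rw [Real.zero_rpow hθ0.ne', mul_zero] at h1
      simpa using ENNReal.tendsto_ofReal h1
    refine tendsto_of_tendsto_of_tendsto_of_le_of_le' tendsto_const_nhds hlim
      (Eventually.of_forall fun n => zero_le) ?_
    filter_upwards [eventually_ge_atTop 1] with n hn
    have hn' : (0 : ℝ) < n := by exact_mod_cast hn
    have hLn := hL n
    have h1 : ⨆ m, (G (cell n m) / (n : ℝ≥0∞)) ^ θ ≤ ENNReal.ofReal ((g₂ / n / n) ^ θ) := by
      refine iSup_le fun m => ?_
      rw [← ENNReal.ofReal_rpow_of_pos (by positivity), ENNReal.ofReal_div_of_pos hn',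
        ENNReal.ofReal_natCast]
      refine ENNReal.rpow_le_rpow (ENNReal.div_le_div_right
        ((measure_cell_le hG₂ hg₂ n m).trans (ENNReal.ofReal_le_ofReal ?_)) _) hθ0.le
      exact div_le_div_of_nonneg_left hg₂.le hn' (by linarith)
    have h2 : ∑ m, blockMoment G q μq (K n) (cell n m) ≤
        ENNReal.ofReal ((A * L n) ^ q * (Mq * Mq) * (g₂ * (2 * (B / L n)) * g₂)) := by
      refine (Finset.sum_le_sum fun m _ => hcell n q μq Mq hq0 hMq hMuq m).trans (le_of_eq ?_)
      rw [Finset.sum_const, Finset.card_univ, Fintype.card_fin, nsmul_eq_mul,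
        ← ENNReal.ofReal_natCast, ← ENNReal.ofReal_mul (by positivity)]
      congr 1
      push_cast
      field_simp
    have h3 : ENNReal.ofReal ((c₁ * L n) ^ (q / 2)) ≤ kernelSize G μ₂ (K n) ^ (q / 2) := by
      rw [← ENNReal.ofReal_rpow_of_pos (hcL n)]
      exact ENNReal.rpow_le_rpow (hsize_low n) (by linarith)
    refine (ENNReal.div_le_div (mul_le_mul' h1 h2) h3).trans (le_of_eq ?_)
    rw [← ENNReal.ofReal_mul (by positivity),
      ← ENNReal.ofReal_div_of_pos (Real.rpow_pos_of_pos (hcL n) _)]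
    congr 1
    have e1 : (g₂ / n / n : ℝ) ^ θ = g₂ ^ θ / ((n : ℝ) ^ 2) ^ θ := by
      rw [div_div, ← sq, Real.div_rpow hg₂.le (by positivity)]
    have e2 : L n ^ q = L n ^ θ * L n ^ (q / 2) * L n := by
      rw [← Real.rpow_add hLn, ← Real.rpow_add_one hLn.ne']
      congr 1
      rw [hθ]
      ring
    rw [e1, Real.mul_rpow hA.le hLn.le, Real.mul_rpow hc₁0.le hLn.le,
      Real.div_rpow hLn.le (by positivity), e2, hc₆]
    have e3 : L n ^ (q / 2) ≠ 0 := (Real.rpow_pos_of_pos hLn _).ne'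
    have e4 : c₁ ^ (q / 2) ≠ 0 := (Real.rpow_pos_of_pos hc₁0 _).ne'
    have e5 : ((n : ℝ) ^ 2) ^ θ ≠ 0 := (Real.rpow_pos_of_pos (by positivity) _).ne'
    have e6 := hLn.ne'
    generalize L n ^ (q / 2) = u at *
    generalize c₁ ^ (q / 2) = v at *
    generalize ((n : ℝ) ^ 2) ^ θ = y at *
    field_simp

/-! ### The main theorem -/

theorem mainTheorem6 (r : ℕ) (hr : 1 ≤ r) :
    -- quasi-interpolants exist, with a constant depending on the order only
    (∃ C : ℝ, ∀ (d l : ℕ) (t : ℤ → ℝ), 1 ≤ d → d ≤ r →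
      IsAugmentedKnots r l t → OuterKnotsControlled r l t →
      ∃ c : ℕ → ℝ → ℝ, IsQuasiInterpolant r d l t C c) ∧
    -- all their symmetrized kernels satisfy the conditions
    (∀ (d : ℕ), 1 ≤ d → d ≤ r →
      ∀ (t : ℕ → ℤ → ℝ), (∀ l, 1 ≤ l → IsAugmentedKnots r l (t l)) →
      ∀ (a b : ℝ), 0 < a →
      (∀ l : ℕ, 1 ≤ l → ∀ i : ℤ, 0 ≤ i → i ≤ l →
        a / l ≤ t l (i + 1) - t l i ∧ t l (i + 1) - t l i ≤ b / l) →
      ∀ (C : ℝ) (c : ℕ → ℕ → ℝ → ℝ), (∀ l, 1 ≤ l → IsQuasiInterpolant r d l (t l) C (c l)) →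
      ∀ (l : ℕ → ℕ), (∀ n, 1 ≤ l n) →
      Tendsto (fun n : ℕ => (l n : ℝ) / n) atTop atTop →
      Tendsto (fun n : ℕ => (l n : ℝ) / (n : ℝ) ^ 2) atTop (𝓝 0) →
      ∀ {Ω : Type*} [MeasurableSpace Ω] (P : Measure Ω) [IsProbabilityMeasure P]
        (X Y : Ω → ℝ), Measurable X → Measurable Y →
      ∀ (G : Measure ℝ), P.map X = G → HasDensityBoundedAway G →
      ∀ (q : ℝ), 2 < q →
      ∀ (μ₂ μq : ℝ → ℝ), IsCondAbsMoment P X Y 2 μ₂ → IsCondAbsMoment P X Y q μq →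
      BoundedAndAway G μ₂ → BoundedAndAway G μq →
      KernelConditions G μ₂ μq q
        (fun n => symmetrize (splineKernel r d (l n) (t (l n)) (c (l n))))) := by
  refine ⟨exists_isQuasiInterpolant r hr, ?_⟩
  intro d hd hdr t ht a b ha hgap C c hc l hl htop hzero Ω _ P _ X Y hX _ G hXG hG q hq μ₂ μq _ _
    hμ₂ hμq
  obtain ⟨n, rfl⟩ : ∃ n, r = n + 1 := ⟨r - 1, by omega⟩
  have : IsProbabilityMeasure G := hXG ▸ Measure.isProbabilityMeasure_map hX.aemeasurable
  have hl0 : ∀ k, (0 : ℝ) < l k := fun k => Nat.cast_pos.2 (hl k)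
  have hb : 0 < b := by
    have h := hgap 1 le_rfl 0 le_rfl (by norm_num)
    have h' := h.1.trans h.2
    norm_num at h'
    linarith
  refine kernelConditions_of_band hG hq hμ₂ hμq (fun k x y => ?_) (fun k => ?_) hl0 htop hzero
    -- The summand 1 only makes `A` positive. `B` arises because, inside [0,1], a support has length
    -- at most n + 1 times the largest gap b/l.
    (A := |C| / a + 1) (B := ((n + 1 : ℕ) : ℝ) * b) (by positivity) (by positivity)
    (fun k => ?_) fun k => ?_
  · simp only [symmetrize, add_comm]
  · have h := measurable_splineKernel (t := t (l k)) (hc (l k) (hl k)).measurable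
    exact (h.add (h.comp measurable_swap)).div_const 2
  · obtain ⟨s, hs⟩ := (ht (l k) (hl k)).exists_layout hd
    obtain ⟨S, hS, h⟩ := hs.exists_kernel_band hd hdr (ht (l k) (hl k)) (hc (l k) (hl k))
      (div_pos ha (hl0 k)) (fun i hi => (hgap (l k) (hl k) i (by omega) (by omega)).1)
      (fun i hi => (hgap (l k) (hl k) i (by omega) (by omega)).2)
    refine ⟨S, hS, fun x hx y hy => ⟨?_, fun hxy => ?_⟩⟩
    · have h1 := abs_le.1 (h x hx y hy).1
      have h2 := abs_le.1 (h y hy x hx).1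
      have h3 : |C| / (a / l k) = |C| / a * l k := by field_simp
      rw [h3] at h1 h2
      have h4 := hl0 k
      rw [symmetrize, abs_le, add_mul]
      constructor <;> linarith
    · rw [mul_div_assoc] at hxy
      rw [symmetrize, (h x hx y hy).2 hxy, (h y hy x hx).2 (by rwa [abs_sub_comm]), add_zero,
        zero_div]
  · obtain ⟨s, hs⟩ := (ht (l k) (hl k)).exists_layout hd
    refine le_trans (ENNReal.ofReal_le_ofReal (Nat.cast_le.2 ?_))
      (hs.le_lintegral_symmetrize_sq hdr (ht (l k) (hl k)) (hc (l k) (hl k)))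
    -- The trace r + ld is at least l because d ≥ 1.
    have := Nat.mul_le_mul_left (l k) hd
    omega
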